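/- Let $\Bbbk$ be a field of characteristic zero. Let $\mathfrak g$ be a free (right) Leibniz algebra over $\Bbbk$ on a set with at least two elements, where the Leibniz identity is $[x,[y,z]]=[[x,y],z]-[[x,z],y]$. Let $B$ be a dual Leibniz algebra, $(xy)z=x(yz+zy)$, and let $M$ be a $B$-bimodule, i.e. a vector space with a left and a right action of $B$ such that this identity holds whenever one of $x,y,z$ lies in $M$ and the other two in $B$. The space $\mathfrak g\otimes B$ is a Lie algebra under $(a\otimes b)*(a'\otimes b')=[a,a']\otimes bb'-[a',a]\otimes b'b$, and it acts on $\mathfrak g\otimes M$ by $(a\otimes b)*(a'\otimes m)=[a,a']\otimes bm-[a',a]\otimes mb$. Let $C^*_{\mathrm{Lie}}(\mathfrak g\otimes B,\mathfrak g\otimes M)$ be its Chevalley–Eilenberg cochain complex: $C^n_{\mathrm{Lie}}$ ($n\ge 0$) is the space of alternating $n$-linear maps $(\mathfrak g\otimes B)^n\to\mathfrak g\otimes M$, and $$(\delta_{\mathrm{Lie}}f)(y_1,\dots,y_{n+1})=\sum_{i<j}(-1)^{i+j}f(y_i*y_j,y_1,\dots,\widehat{y_i},\dots,\widehat{y_j},\dots,y_{n+1})+\sum_{i=1}^{n+1}(-1)^{i+1}y_i*f(y_1,\dots,\widehat{y_i},\dots,y_{n+1}).$$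 Let $C^*_{\mathcal{DL}}(B,M)$ be the dual Leibniz cochain complex: $C^0_{\mathcal{DL}}=0$, and for $n\ge 1$, $C^n_{\mathcal{DL}}$ is the space of $n$-linear maps $B^n\to M$, with $$\begin{aligned}(\delta_{\mathcal{DL}} f)(x_1,\dots,x_{n+1})={}&x_1\cdot\sum_{i=0}^{n-1}\sum_{\sigma}(-1)^i\operatorname{sgn}(\sigma)\,f(x_{\sigma(1)+1},\dots,x_{\sigma(n)+1})\\&+\sum_{i=1}^{n}(-1)^i f(x_1,\dots,x_ix_{i+1},\dots,x_{n+1})+\sum_{i=2}^{n}(-1)^i f(x_1,\dots,x_{i+1}x_i,\dots,x_{n+1})\\&+(-1)^{n+1}f(x_1,\dots,x_n)\cdot x_{n+1},\end{aligned}$$ where, for each $i$, the inner sum is over the $\sigma\in S_n$ such that the word $\sigma^{-1}(1)\cdots\sigma^{-1}(n)$ is decreasing in its first $i$ letters, increasing in its last $n-i$ letters, and has $(i+1)$-st letter $1$. Finally let $\Psi:C^n_{\mathcal{DL}}(B,M)\to C^n_{\mathrm{Lie}}(\mathfrak g\otimes B,\mathfrak g\otimes M)$ be $0$ for $n=0$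 and, for $n\ge1$, $$\Psi(f)(a_1\otimes b_1,\dots,a_n\otimes b_n)=\sum_{\sigma\in S_n}\operatorname{sgn}(\sigma)\,[[[a_{\sigma(1)},a_{\sigma(2)}],\cdots],a_{\sigma(n)}]\otimes f(b_{\sigma(1)},\dots,b_{\sigma(n)}).$$ Then $C^*_{\mathcal{DL}}(B,M)$ and $C^*_{\mathrm{Lie}}(\mathfrak g\otimes B,\mathfrak g\otimes M)$ are cochain complexes, $\Psi$ is a morphism of cochain complexes, and with the quotient complex $Q^*=C^*_{\mathrm{Lie}}(\mathfrak g\otimes B,\mathfrak g\otimes M)/\Psi(C^*_{\mathcal{DL}}(B,M))$ the sequence $$0\to C^*_{\mathcal{DL}}(B,M)\xrightarrow{\ \Psi\ }C^*_{\mathrm{Lie}}(\mathfrak g\otimes B,\mathfrak g\otimes M)\to Q^*\to 0$$ is a short exact sequence of cochain complexes. Consequently, with the connecting homomorphisms of this short exact sequence, there is a long exact sequence, starting with an injection in degree $0$, $$0\to H^0_{\mathcal{DL}}(B,M)\to\cdots\to H^{n}_{\mathcal{DL}}(B,M)\to H^{n}_{\mathrm{Lie}}(\mathfrak g\otimes B,\mathfrak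 g\otimes M)\to H^{n}(Q^*)\to H^{n+1}_{\mathcal{DL}}(B,M)\to H^{n+1}_{\mathrm{Lie}}(\mathfrak g\otimes B,\mathfrak g\otimes M)\to\cdots .$$ -/

import Mathlib

set_option linter.unusedSectionVars false

open CategoryTheory TensorProduct

universe u

namespace DualLeibniz

/-! ### Leibniz algebras and free Leibniz algebras -/

/-- A (not necessarily associative) algebra is a right Leibniz algebra if its product, which plays
the role of the bracket `[x, y]`, satisfies `[x, [y, z]] = [[x, y], z] - [[x, z], y]`. -/
class IsLeibniz (g : Type*) [NonUnitalNonAssocRing g] : Prop where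
  leibniz : ∀ x y z : g, x * (y * z) = (x * y) * z - (x * z) * y

section Free

variable (k : Type*) [Field k] (X : Type*)

/-- The Leibniz ideal of the free nonassociative algebra on `X`: the smallest two-sided ideal
that contains all the elements `a(bc) - ((ab)c - (ac)b)`. -/
noncomputable def leibnizIdeal : Submodule k (FreeNonUnitalNonAssocAlgebra k X) :=
  sInf {p | (∀ a b c : FreeNonUnitalNonAssocAlgebra k X,
      a * (b * c) - ((a * b) * c - (a * c) * b) ∈ p) ∧
    ∀ a, ∀ u ∈ p, a * u ∈ p ∧ u * a ∈ p}

variable {k X}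

theorem leibniz_mem_leibnizIdeal (a b c : FreeNonUnitalNonAssocAlgebra k X) :
    a * (b * c) - ((a * b) * c - (a * c) * b) ∈ leibnizIdeal k X :=
  Submodule.mem_sInf.2 fun _ hp => hp.1 a b c

theorem mul_mem_leibnizIdeal (a : FreeNonUnitalNonAssocAlgebra k X)
    {u : FreeNonUnitalNonAssocAlgebra k X} (hu : u ∈ leibnizIdeal k X) :
    a * u ∈ leibnizIdeal k X ∧ u * a ∈ leibnizIdeal k X :=
  ⟨Submodule.mem_sInf.2 fun p hp => (hp.2 a u (Submodule.mem_sInf.1 hu p hp)).1,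
    Submodule.mem_sInf.2 fun p hp => (hp.2 a u (Submodule.mem_sInf.1 hu p hp)).2⟩

variable (k X)

/-- The free Leibniz algebra on the set `X`. -/
def FreeLeibniz := FreeNonUnitalNonAssocAlgebra k X ⧸ leibnizIdeal k X

namespace FreeLeibniz

noncomputable instance : AddCommGroup (FreeLeibniz k X) :=
  inferInstanceAs (AddCommGroup (FreeNonUnitalNonAssocAlgebra k X ⧸ leibnizIdeal k X))

noncomputable instance : Module k (FreeLeibniz k X) :=
  inferInstanceAs (Module k (FreeNonUnitalNonAssocAlgebra k X ⧸ leibnizIdeal k X))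

/-- The quotient map from the free nonassociative algebra. -/
noncomputable def mk : FreeNonUnitalNonAssocAlgebra k X →ₗ[k] FreeLeibniz k X :=
  (leibnizIdeal k X).mkQ

theorem mk_surjective : Function.Surjective (mk k X) := Submodule.mkQ_surjective _

/-- The bracket of the free Leibniz algebra. -/
noncomputable def bracket : FreeLeibniz k X →ₗ[k] FreeLeibniz k X →ₗ[k] FreeLeibniz k X :=
  (leibnizIdeal k X).liftQ
    ((leibnizIdeal k X).liftQ
      ((LinearMap.mul k (FreeNonUnitalNonAssocAlgebra k X)).compr₂ (mk k X)).flip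
      (fun u hu => by
        refine LinearMap.ext fun a => ?_
        exact (Submodule.Quotient.mk_eq_zero _).2 (mul_mem_leibnizIdeal a hu).1)).flip
    (fun u hu => by
      refine LinearMap.ext fun a => ?_
      obtain ⟨a, rfl⟩ := mk_surjective k X a
      exact (Submodule.Quotient.mk_eq_zero _).2 (mul_mem_leibnizIdeal a hu).2)

noncomputable instance : NonUnitalNonAssocRing (FreeLeibniz k X) where
  mul a b := bracket k X a b
  left_distrib a b c := map_add (bracket k X a) b c
  right_distrib a b c := LinearMap.map_add₂ (bracket k X) a b c
  zero_mul a := LinearMap.map_zero₂ (bracket k X) a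
  mul_zero a := map_zero (bracket k X a)

instance : IsScalarTower k (FreeLeibniz k X) (FreeLeibniz k X) :=
  ⟨fun t a b => LinearMap.map_smul₂ (bracket k X) t a b⟩

instance : SMulCommClass k (FreeLeibniz k X) (FreeLeibniz k X) :=
  ⟨fun t a b => (map_smul (bracket k X a) t b).symm⟩

theorem mk_mul (a b : FreeNonUnitalNonAssocAlgebra k X) :
    mk k X (a * b) = mk k X a * mk k X b := rfl

instance : IsLeibniz (FreeLeibniz k X) where
  leibniz x y z := by
    obtain ⟨x, rfl⟩ := mk_surjective k X x
    obtain ⟨y, rfl⟩ := mk_surjective k X y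
    obtain ⟨z, rfl⟩ := mk_surjective k X z
    simp only [← mk_mul, ← map_sub]
    exact (Submodule.Quotient.eq _).2 (leibniz_mem_leibnizIdeal x y z)

variable {X}

/-- The canonical map from `X` to the free Leibniz algebra on `X`. -/
noncomputable def of (x : X) : FreeLeibniz k X := mk k X (FreeNonUnitalNonAssocAlgebra.of k x)

variable {g : Type*} [NonUnitalNonAssocRing g] [Module k g] [IsScalarTower k g g]
  [SMulCommClass k g g] [IsLeibniz g]

/-- The homomorphism of Leibniz algebras `FreeLeibniz k X → g` that extends `ι : X → g`. -/
noncomputable def lift (ι : X → g) : FreeLeibniz k X →ₙₐ[k] g :=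
  let F := FreeNonUnitalNonAssocAlgebra.lift k ι
  let φ : FreeLeibniz k X →ₗ[k] g :=
    (leibnizIdeal k X).liftQ (F : FreeNonUnitalNonAssocAlgebra k X →ₗ[k] g) (by
      refine sInf_le ⟨fun a b c => ?_, fun a u hu => ?_⟩
      · simp [IsLeibniz.leibniz]
      · have hu' : F u = 0 := hu
        constructor <;> simp [hu'])
  { φ with
    map_zero' := map_zero φ
    map_mul' := fun a b => by
      obtain ⟨a, rfl⟩ := mk_surjective k X a
      obtain ⟨b, rfl⟩ := mk_surjective k X b
      exact map_mul F a b }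

@[simp]
theorem lift_of (ι : X → g) (x : X) : lift k ι (of k x) = ι x :=
  FreeNonUnitalNonAssocAlgebra.lift_of_apply k ι x

theorem hom_ext {F G : FreeLeibniz k X →ₙₐ[k] g} (h : ∀ x, F (of k x) = G (of k x)) : F = G := by
  let π : FreeNonUnitalNonAssocAlgebra k X →ₙₐ[k] FreeLeibniz k X :=
    { mk k X with
      map_zero' := map_zero (mk k X)
      map_mul' := mk_mul k X }
  have : F.comp π = G.comp π := FreeNonUnitalNonAssocAlgebra.hom_ext k h
  ext a
  obtain ⟨a, rfl⟩ := mk_surjective k X a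
  exact congrArg (fun φ => φ a) this

end FreeLeibniz

variable {X} {g : Type*} [NonUnitalNonAssocRing g] [Module k g] [IsScalarTower k g g]
  [SMulCommClass k g g] [IsLeibniz g]

/-- The Leibniz algebra `g` is free on the family `ι : X → g`. -/
def IsFreeLeibnizOn (ι : X → g) : Prop := Function.Bijective (FreeLeibniz.lift k ι)

end Free

/-! ### Dual Leibniz algebras and their bimodules -/

/-- A (not necessarily associative) algebra is a dual Leibniz (Zinbiel) algebra if
`(x y) z = x (y z + z y)`. -/
class IsDualLeibniz (B : Type*) [NonUnitalNonAssocRing B] : Prop where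
  mul_mul : ∀ x y z : B, (x * y) * z = x * (y * z + z * y)

/-- A bimodule (representation) `M` of the dual Leibniz algebra `B`: a left action `x · m` and a
right action `m · x`, such that the identity of a dual Leibniz algebra holds whenever one of its
three arguments is in `M` and the other two are in `B`. -/
class DualLeibnizBimodule (k B M : Type*) [Field k] [NonUnitalNonAssocRing B] [Module k B]
    [AddCommGroup M] [Module k M] where
  /-- the left action `x · m` -/
  lact : B →ₗ[k] M →ₗ[k] M
  /-- the right action `m · x` -/
  ract : M →ₗ[k] B →ₗ[k] M
  ract_ract : ∀ (m : M) (y z : B), ract (ract m y) z = ract m (y * z + z * y)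
  ract_lact : ∀ (x : B) (m : M) (z : B), ract (lact x m) z = lact x (ract m z + lact z m)
  lact_mul : ∀ (x y : B) (m : M), lact (x * y) m = lact x (lact y m + ract m y)

/-! ### The Lie algebra `g ⊗ B` and its module `g ⊗ M` -/

section Tensor

variable {k g B M : Type*} [Field k]
  [NonUnitalNonAssocRing g] [Module k g] [IsScalarTower k g g] [SMulCommClass k g g] [IsLeibniz g]
  [NonUnitalNonAssocRing B] [Module k B] [IsScalarTower k B B] [SMulCommClass k B B]
  [AddCommGroup M] [Module k M]

variable (k g B M) in
/-- The action of `g ⊗ B` on `g ⊗ M`: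
`(a ⊗ b) * (a' ⊗ m) = [a, a'] ⊗ (b · m) - [a', a] ⊗ (m · b)`. -/
noncomputable def tensorAction [DualLeibnizBimodule k B M] :
    g ⊗[k] B →ₗ[k] g ⊗[k] M →ₗ[k] g ⊗[k] M :=
  TensorProduct.map₂ (LinearMap.mul k g) (DualLeibnizBimodule.lact (k := k) (B := B) (M := M)) -
    (TensorProduct.map₂ (LinearMap.mul k g)
      (DualLeibnizBimodule.ract (k := k) (B := B) (M := M))).flip

theorem tensorAction_tmul [DualLeibnizBimodule k B M] (a a' : g) (b : B) (m : M) :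
    tensorAction k g B M (a ⊗ₜ b) (a' ⊗ₜ m) =
      (a * a') ⊗ₜ DualLeibnizBimodule.lact (k := k) b m -
        (a' * a) ⊗ₜ DualLeibnizBimodule.ract (k := k) m b := by
  simp [tensorAction]

/-- Mathlib's bracket on the nonassociative algebra `g ⊗ B` is its commutator. -/
theorem lie_tmul_tmul (a a' : g) (b b' : B) :
    ⁅a ⊗ₜ[k] b, a' ⊗ₜ[k] b'⁆ = (a * a') ⊗ₜ[k] (b * b') - (a' * a) ⊗ₜ[k] (b' * b) := by
  simp [Ring.lie_def]

variable [IsDualLeibniz B]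

/-- The Lie algebra `g ⊗ B`, with bracket `⁅x, y⁆ = x * y - y * x`, that is,
`⁅a ⊗ b, a' ⊗ b'⁆ = [a, a'] ⊗ (b b') - [a', a] ⊗ (b' b)`. -/
noncomputable instance : LieRing (g ⊗[k] B) where
  add_lie x y z := by simp only [Ring.lie_def, add_mul, mul_add]; abel
  lie_add x y z := by simp only [Ring.lie_def, add_mul, mul_add]; abel
  lie_self x := by simp only [Ring.lie_def, sub_self]
  leibniz_lie x y z := by
    simp only [Ring.lie_def]
    induction x with
    | zero => simp
    | add x x' h h' =>
      simp only [add_mul, mul_add, mul_sub, sub_mul] at h h' ⊢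
      refine Eq.trans ?_ ((congrArg₂ (· + ·) h h').trans ?_) <;> abel
    | tmul a b =>
    induction y with
    | zero => simp
    | add x x' h h' =>
      simp only [add_mul, mul_add, mul_sub, sub_mul] at h h' ⊢
      refine Eq.trans ?_ ((congrArg₂ (· + ·) h h').trans ?_) <;> abel
    | tmul a' b' =>
    induction z with
    | zero => simp
    | add x x' h h' =>
      simp only [add_mul, mul_add, mul_sub, sub_mul] at h h' ⊢
      refine Eq.trans ?_ ((congrArg₂ (· + ·) h h').trans ?_) <;> abel
    | tmul a'' b'' =>
      simp only [mul_sub, sub_mul, Algebra.TensorProduct.tmul_mul_tmul, IsLeibniz.leibniz,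
        IsDualLeibniz.mul_mul, TensorProduct.sub_tmul, TensorProduct.tmul_add, mul_add]
      abel

noncomputable instance : LieAlgebra k (g ⊗[k] B) where
  lie_smul t x y := by simp only [Ring.lie_def, smul_sub, mul_smul_comm, smul_mul_assoc]

variable [DualLeibnizBimodule k B M]

noncomputable instance : LieRingModule (g ⊗[k] B) (g ⊗[k] M) where
  bracket x m := tensorAction k g B M x m
  add_lie x y m := LinearMap.map_add₂ _ x y m
  lie_add x m n := map_add _ m n
  leibniz_lie x y m := by
    change tensorAction k g B M x (tensorAction k g B M y m) =
      tensorAction k g B M (x * y - y * x) m + tensorAction k g B M y (tensorAction k g B M x m)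
    induction x with
    | zero => simp
    | add x x' h h' =>
      simp only [add_mul, mul_add, map_add, map_sub, LinearMap.add_apply, LinearMap.sub_apply]
        at h h' ⊢
      rw [h, h']; abel
    | tmul a b =>
    induction y with
    | zero => simp
    | add x x' h h' =>
      simp only [add_mul, mul_add, map_add, map_sub, LinearMap.add_apply, LinearMap.sub_apply]
        at h h' ⊢
      rw [h, h']; abel
    | tmul a' b' =>
    induction m with
    | zero => simp
    | add x x' h h' => simp only [map_add, h, h']; abel
    | tmul a'' m =>
      simp only [map_sub, LinearMap.sub_apply, Algebra.TensorProduct.tmul_mul_tmul,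
        tensorAction_tmul, IsLeibniz.leibniz, DualLeibnizBimodule.ract_ract,
        DualLeibnizBimodule.ract_lact, DualLeibnizBimodule.lact_mul, map_add,
        TensorProduct.sub_tmul, TensorProduct.tmul_add]
      abel

/-- The action of `g ⊗ B` on `g ⊗ M`. -/
theorem lie_tmul_tmul_module (a a' : g) (b : B) (m : M) :
    ⁅a ⊗ₜ[k] b, a' ⊗ₜ[k] m⁆ =
      (a * a') ⊗ₜ[k] DualLeibnizBimodule.lact (k := k) b m -
        (a' * a) ⊗ₜ[k] DualLeibnizBimodule.ract (k := k) m b :=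
  tensorAction_tmul a a' b m

noncomputable instance : LieModule k (g ⊗[k] B) (g ⊗[k] M) where
  smul_lie t x m := LinearMap.map_smul₂ (tensorAction k g B M) t x m
  lie_smul t x m := map_smul (tensorAction k g B M x) t m

end Tensor

/-! ### The Chevalley-Eilenberg complex of a Lie algebra -/

section ChevalleyEilenberg

variable {k L N : Type*} [Field k] [CharZero k] [LieRing L] [LieAlgebra k L]
  [AddCommGroup N] [Module k N] [LieRingModule L N] [LieModule k L N]

/-- The part `∑_i (-1)^(i+1) x_i * f(x_1, …, x̂_i, …, x_(n+1))` of the coboundary. The index `i`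
of `Fin (n + 1)` starts from `0`, which accounts for the sign. -/
noncomputable def lieActionPart (n : ℕ) : (L [⋀^Fin n]→ₗ[k] N) →ₗ[k] L [⋀^Fin (n + 1)]→ₗ[k] N where
  toFun f := AlternatingMap.alternatizeUncurryFin
    { toFun := fun x => (LieModule.toEnd k L N x).compAlternatingMap f
      map_add' := fun x y => by ext; simp
      map_smul' := fun t x => by ext; simp }
  map_add' f f' := by
    ext v
    simp [AlternatingMap.alternatizeUncurryFin_apply, Finset.sum_add_distrib]
  map_smul' t f := by
    ext v
    simp [AlternatingMap.alternatizeUncurryFin_apply, Finset.smul_sum, smul_comm t]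

theorem lieActionPart_apply (n : ℕ) (f : L [⋀^Fin n]→ₗ[k] N) (v : Fin (n + 1) → L) :
    lieActionPart n f v = ∑ i : Fin (n + 1), (-1 : ℤ) ^ (i : ℕ) • ⁅v i, f (i.removeNth v)⁆ := by
  simp [lieActionPart, AlternatingMap.alternatizeUncurryFin_apply]

/-- The map `(x, y) ↦ f(x * y, -)`. -/
noncomputable def bracketCurry (m : ℕ) :
    (L [⋀^Fin (m + 1)]→ₗ[k] N) →ₗ[k] L →ₗ[k] L →ₗ[k] L [⋀^Fin m]→ₗ[k] N where
  toFun f := (LieModule.toEnd k L L : L →ₗ[k] Module.End k L).compr₂ f.curryLeft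
  map_add' f f' := by ext; simp
  map_smul' t f := by ext; simp

/-- The part `∑_(i<j) (-1)^(i+j) f(x_i * x_j, x_1, …, x̂_i, …, x̂_j, …, x_(n+1))` of the coboundary
in degree `n = m + 1`, see `lieBracketPart_apply`; it is built as one half of the alternating sum
over all the ordered pairs of arguments. -/
noncomputable def lieBracketPart (m : ℕ) :
    (L [⋀^Fin (m + 1)]→ₗ[k] N) →ₗ[k] L [⋀^Fin (m + 2)]→ₗ[k] N where
  toFun f := (-2⁻¹ : k) • AlternatingMap.alternatizeUncurryFin
    (AlternatingMap.alternatizeUncurryFinLM ∘ₗ bracketCurry m f)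
  map_add' f f' := by
    rw [map_add, LinearMap.comp_add, AlternatingMap.alternatizeUncurryFin_add, smul_add]
  map_smul' t f := by
    rw [map_smul, LinearMap.comp_smul, AlternatingMap.alternatizeUncurryFin_smul, smul_comm,
      RingHom.id_apply]

/-- The pairs `i < j` of indices in `{0, …, m + 1}` are written as `(i.castSucc, j.succ)` with
`i ≤ j` in `Fin (m + 1)`; in `1`-based numbering they are `i + 1` and `j + 2`. -/
theorem lieBracketPart_apply (m : ℕ) (f : L [⋀^Fin (m + 1)]→ₗ[k] N) (v : Fin (m + 2) → L) :
    lieBracketPart m f v = ∑ i : Fin (m + 1), ∑ j ≥ i, (-1 : ℤ) ^ ((i + 1) + (j + 2) : ℕ) •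
      f (Fin.cons ⁅v i.castSucc, v j.succ⁆ (j.removeNth (i.castSucc.removeNth v))) := by
  have h : ∀ (x y : L) (w : Fin m → L),
      bracketCurry m f x y w - bracketCurry m f y x w = (2 : k) • f (Fin.cons ⁅x, y⁆ w) := by
    intro x y w
    change f.curryLeft ⁅x, y⁆ w - f.curryLeft ⁅y, x⁆ w = (2 : k) • f.curryLeft ⁅x, y⁆ w
    rw [← lie_skew x y, map_neg, AlternatingMap.neg_apply, two_smul]
    abel
  simp only [lieBracketPart, LinearMap.coe_mk, AddHom.coe_mk, AlternatingMap.smul_apply,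
    AlternatingMap.alternatizeUncurryFin_alternatizeUncurryFinLM_comp_apply, h,
    Finset.smul_sum]
  refine Finset.sum_congr rfl fun i _ => Finset.sum_congr rfl fun j _ => ?_
  rw [smul_comm ((-1 : ℤ) ^ _) (2 : k), smul_smul, neg_mul, inv_mul_cancel₀ two_ne_zero, neg_smul,
    one_smul, ← neg_smul]
  congr 1
  ring

/-- The Chevalley-Eilenberg coboundary
`(δ f)(x_1, …, x_(n+1)) = ∑_(i<j) (-1)^(i+j) f(x_i * x_j, x_1, …, x̂_i, …, x̂_j, …, x_(n+1)) +
  ∑_i (-1)^(i+1) x_i * f(x_1, …, x̂_i, …, x_(n+1))`. -/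
noncomputable def lieCoboundary :
    ∀ n : ℕ, (L [⋀^Fin n]→ₗ[k] N) →ₗ[k] L [⋀^Fin (n + 1)]→ₗ[k] N
  | 0 => lieActionPart 0
  | m + 1 => lieBracketPart m + lieActionPart (m + 1)

end ChevalleyEilenberg

/-! ### The coboundary of a dual Leibniz algebra -/

section DualLeibnizCoboundary

variable {k B M : Type*} [Field k] [NonUnitalNonAssocRing B] [Module k B] [IsScalarTower k B B]
  [SMulCommClass k B B] [AddCommGroup M] [Module k M] [DualLeibnizBimodule k B M]

open DualLeibnizBimodule

/-- The permutations `σ` of `n` letters with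
`(σ(β(i)), …, σ(β(1)), σ(α(1)), …, σ(α(n-i))) = (1, …, n)` for some `(n-i, i)`-shuffle `(α, β)`
with `α(1) = 1`. In other words, the word `σ⁻¹ = (β(i), …, β(1), α(1), …, α(n-i))` is
decreasing on its first `i` letters, increasing on the other ones, and the first of the latter is
the smallest letter. (Letters and positions are numbered from `0` here.) -/
def IsInverseShuffle {n : ℕ} (i : Fin n) (σ : Equiv.Perm (Fin n)) : Prop :=
  StrictAntiOn (σ⁻¹ : Equiv.Perm (Fin n)) {p | p < i} ∧
    StrictMonoOn (σ⁻¹ : Equiv.Perm (Fin n)) {p | i ≤ p} ∧ ((σ⁻¹ i : Fin n) : ℕ) = 0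

open Classical in
/-- The cochain `(x_1, …, x_n) ↦ ∑_σ (-1)^i sgn(σ) f(x_σ(1), …, x_σ(n))`, where `σ` runs over
the permutations of `IsInverseShuffle`. -/
noncomputable def shuffleSum {n : ℕ} :
    MultilinearMap k (fun _ : Fin n => B) M →ₗ[k] MultilinearMap k (fun _ : Fin n => B) M :=
  ∑ i : Fin n, ∑ σ : Equiv.Perm (Fin n) with IsInverseShuffle i σ,
    ((-1) ^ (i : ℕ) * ((Equiv.Perm.sign σ : ℤ) : k)) •
      (MultilinearMap.domDomCongrLinearEquiv k k B M σ).toLinearMap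

/-- Replacing one entry of `x` changes at most one entry of `contractNth i.castSucc μ x`, and the
latter depends linearly on the former. -/
theorem exists_contractNth_update {n : ℕ} (μ : B →ₗ[k] B →ₗ[k] B) (i : Fin n)
    (x : Fin (n + 1) → B) (p : Fin (n + 1)) :
    ∃ (q : Fin n) (ℓ : B →ₗ[k] B), ∀ a,
      i.castSucc.contractNth (fun b c => μ b c) (Function.update x p a) =
        Function.update (i.castSucc.contractNth (fun b c => μ b c) x) q (ℓ a) := by
  classical
  rcases lt_trichotomy (p : ℕ) i with hp | hp | hp
  · refine ⟨⟨p, hp.trans i.2⟩, LinearMap.id, fun a => funext fun q => ?_⟩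
    simp only [Fin.contractNth, Function.update_apply, Fin.ext_iff, Fin.val_castSucc, Fin.val_succ,
      LinearMap.id_apply]
    split_ifs <;> first | rfl | omega
  · refine ⟨i, μ.flip (x i.succ), fun a => funext fun q => ?_⟩
    simp only [Fin.contractNth, Function.update_apply, Fin.ext_iff, Fin.val_castSucc, Fin.val_succ,
      LinearMap.flip_apply]
    split_ifs <;> first | rfl | omega | skip
    obtain rfl : q = i := Fin.ext (by omega)
    rfl
  · rcases Nat.lt_or_ge ((i : ℕ) + 1) p with hp' | hp'
    · refine ⟨⟨p - 1, by omega⟩, LinearMap.id, fun a => funext fun q => ?_⟩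
      simp only [Fin.contractNth, Function.update_apply, Fin.ext_iff, Fin.val_castSucc,
        Fin.val_succ, LinearMap.id_apply]
      split_ifs <;> first | rfl | omega
    · refine ⟨i, μ (x i.castSucc), fun a => funext fun q => ?_⟩
      simp only [Fin.contractNth, Function.update_apply, Fin.ext_iff, Fin.val_castSucc,
        Fin.val_succ]
      split_ifs <;> first | rfl | omega | skip
      obtain rfl : q = i := Fin.ext (by omega)
      rfl

/-- The cochain `(x_1, …, x_(n+1)) ↦ f(x_1, …, μ(x_i, x_(i+1)), …, x_(n+1))` (here `i` is numbered
from `0`). -/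
noncomputable def contract {n : ℕ} (μ : B →ₗ[k] B →ₗ[k] B) (i : Fin n) :
    MultilinearMap k (fun _ : Fin n => B) M →ₗ[k]
      MultilinearMap k (fun _ : Fin (n + 1) => B) M where
  toFun f :=
    { toFun := fun x => f (i.castSucc.contractNth (fun b c => μ b c) x)
      map_update_add' := fun {inst} x p a b => by
        obtain rfl : inst = instDecidableEqFin (n + 1) := Subsingleton.elim _ _
        obtain ⟨q, ℓ, h⟩ := exists_contractNth_update μ i x p
        simp [h]
      map_update_smul' := fun {inst} x p t a => by
        obtain rfl : inst = instDecidableEqFin (n + 1) := Subsingleton.elim _ _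
        obtain ⟨q, ℓ, h⟩ := exists_contractNth_update μ i x p
        simp [h] }
  map_add' _ _ := rfl
  map_smul' _ _ := rfl

/-- The cochain `(x_1, …, x_(n+1)) ↦ x_1 · f(x_2, …, x_(n+1))`. -/
noncomputable def leftPart (n : ℕ) :
    MultilinearMap k (fun _ : Fin n => B) M →ₗ[k]
      MultilinearMap k (fun _ : Fin (n + 1) => B) M where
  toFun f := LinearMap.uncurryLeft
    { toFun := fun b => (lact (k := k) (B := B) (M := M) b).compMultilinearMap f
      map_add' := fun b c => by ext; simp
      map_smul' := fun t b => by ext; simp }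
  map_add' f f' := by ext; simp
  map_smul' t f := by ext; simp

theorem leftPart_apply (n : ℕ) (f : MultilinearMap k (fun _ : Fin n => B) M)
    (x : Fin (n + 1) → B) : leftPart n f x = lact (k := k) (x 0) (f (Fin.tail x)) := rfl

/-- The cochain `(x_1, …, x_(n+1)) ↦ f(x_1, …, x_n) · x_(n+1)`. -/
noncomputable def rightPart (n : ℕ) :
    MultilinearMap k (fun _ : Fin n => B) M →ₗ[k]
      MultilinearMap k (fun _ : Fin (n + 1) => B) M where
  toFun f := MultilinearMap.uncurryRight
    ((ract (k := k) (B := B) (M := M)).compMultilinearMap f)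
  map_add' f f' := by ext; simp
  map_smul' t f := by ext; simp

theorem rightPart_apply (n : ℕ) (f : MultilinearMap k (fun _ : Fin n => B) M)
    (x : Fin (n + 1) → B) :
    rightPart n f x = ract (k := k) (f (Fin.init x)) (x (Fin.last n)) := rfl

/-- The coboundary of dual Leibniz cochains of degree `n ≥ 1`; its value is written out in
`dualLeibnizCoboundary_apply`. -/
noncomputable def dualLeibnizCoboundary (n : ℕ) :
    MultilinearMap k (fun _ : Fin n => B) M →ₗ[k]
      MultilinearMap k (fun _ : Fin (n + 1) => B) M :=
  leftPart n ∘ₗ shuffleSum +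
    ∑ i : Fin n, (-1 : k) ^ ((i : ℕ) + 1) • contract (LinearMap.mul k B) i +
    ∑ i ∈ Finset.univ.filter (fun i : Fin n => 0 < (i : ℕ)), (-1 : k) ^ ((i : ℕ) + 1) • contract (LinearMap.mul k B).flip i +
    (-1 : k) ^ (n + 1) • rightPart n

open Classical in
theorem dualLeibnizCoboundary_apply (n : ℕ) (f : MultilinearMap k (fun _ : Fin n => B) M)
    (x : Fin (n + 1) → B) :
    dualLeibnizCoboundary n f x =
      lact (k := k) (x 0) (∑ i : Fin n, ∑ σ : Equiv.Perm (Fin n) with IsInverseShuffle i σ,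
        ((-1) ^ (i : ℕ) * ((Equiv.Perm.sign σ : ℤ) : k)) • f (fun p => x (σ p).succ)) +
      ∑ i : Fin n, (-1 : k) ^ ((i : ℕ) + 1) • f (i.castSucc.contractNth (fun b c => b * c) x) +
      ∑ i ∈ Finset.univ.filter (fun i : Fin n => 0 < (i : ℕ)),
        (-1 : k) ^ ((i : ℕ) + 1) • f (i.castSucc.contractNth (fun b c => c * b) x) +
      (-1 : k) ^ (n + 1) • ract (k := k) (f (Fin.init x)) (x (Fin.last n)) := by
  simp [dualLeibnizCoboundary, leftPart_apply, rightPart_apply, shuffleSum, contract,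
    Fin.tail, MultilinearMap.domDomCongr_apply]

end DualLeibnizCoboundary

/-! ### The map `Ψ` -/

section Psi

variable {k g B M : Type*} [Field k]
  [NonUnitalNonAssocRing g] [Module k g] [IsScalarTower k g g] [SMulCommClass k g g]
  [AddCommGroup B] [Module k B] [AddCommGroup M] [Module k M]

variable (k g) in
/-- The left-normed bracket `[x_1, …, x_(n+1)] = [[x_1, …, x_n], x_(n+1)]`, where `[x_1] = x_1`. -/
noncomputable def leftNormed : ∀ n : ℕ, MultilinearMap k (fun _ : Fin (n + 1) => g) g
  | 0 => MultilinearMap.ofSubsingleton k g g (0 : Fin 1) LinearMap.id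
  | n + 1 => MultilinearMap.uncurryRight ((LinearMap.mul k g).compMultilinearMap (leftNormed n))

@[simp]
theorem leftNormed_zero (x : Fin 1 → g) : leftNormed k g 0 x = x 0 := rfl

theorem leftNormed_succ (n : ℕ) (x : Fin (n + 2) → g) :
    leftNormed k g (n + 1) x = leftNormed k g n (Fin.init x) * x (Fin.last (n + 1)) := rfl

/-- The multilinear map `(v_1, …, v_(n+1)) ↦ φ(v_1)(v_2, …, v_(n+1))`, linear in `φ`. -/
noncomputable def uncurryFirst {V Q : Type*} [AddCommGroup V] [Module k V] [AddCommGroup Q]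
    [Module k Q] (n : ℕ) : (V →ₗ[k] MultilinearMap k (fun _ : Fin n => V) Q) →ₗ[k]
      MultilinearMap k (fun _ : Fin (n + 1) => V) Q where
  toFun φ := LinearMap.uncurryLeft φ
  map_add' _ _ := rfl
  map_smul' _ _ := rfl

/-- For multilinear maps `A : g^n → P` and `f : B^n → M`, the multilinear map
`(g ⊗ B)^n → P ⊗ M` with `(x_i ⊗ b_i)_i ↦ A(x_1, …, x_n) ⊗ f(b_1, …, b_n)`. -/
noncomputable def tensorMultilinear {P : Type*} [AddCommGroup P] [Module k P] : ∀ n : ℕ,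
    MultilinearMap k (fun _ : Fin n => g) P →ₗ[k] MultilinearMap k (fun _ : Fin n => B) M →ₗ[k]
      MultilinearMap k (fun _ : Fin n => g ⊗[k] B) (P ⊗[k] M)
  | 0 => LinearMap.mk₂ k
      (fun A f => MultilinearMap.constOfIsEmpty k _ (A Fin.elim0 ⊗ₜ[k] f Fin.elim0))
      (fun A A' f => by ext; simp [TensorProduct.add_tmul])
      (fun t A f => by ext; simp [TensorProduct.smul_tmul'])
      (fun A f f' => by ext; simp [TensorProduct.tmul_add])
      (fun t A f => by ext; simp)
  | n + 1 => LinearMap.mk₂ k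
      (fun A f => uncurryFirst n (TensorProduct.lift
        ((tensorMultilinear n).compl₁₂ A.curryLeft f.curryLeft)))
      (fun A A' f => by
        have h : (A + A').curryLeft = A.curryLeft + A'.curryLeft := rfl
        rw [h, ← map_add]
        congr 1
        ext; simp)
      (fun t A f => by
        have h : (t • A).curryLeft = t • A.curryLeft := rfl
        rw [h, ← map_smul]
        congr 1
        ext; simp)
      (fun A f f' => by
        have h : (f + f').curryLeft = f.curryLeft + f'.curryLeft := rfl
        rw [h, ← map_add]
        congr 1
        ext; simp)
      (fun t A f => by
        have h : (t • f).curryLeft = t • f.curryLeft := rfl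
        rw [h, ← map_smul]
        congr 1
        ext; simp)

theorem tensorMultilinear_tmul {P : Type*} [AddCommGroup P] [Module k P] (n : ℕ)
    (A : MultilinearMap k (fun _ : Fin n => g) P) (f : MultilinearMap k (fun _ : Fin n => B) M)
    (x : Fin n → g) (b : Fin n → B) :
    tensorMultilinear n A f (fun i => x i ⊗ₜ[k] b i) = A x ⊗ₜ[k] f b := by
  induction n with
  | zero =>
    obtain rfl : x = Fin.elim0 := Subsingleton.elim _ _
    obtain rfl : b = Fin.elim0 := Subsingleton.elim _ _
    rfl
  | succ n ih =>
    refine (ih (A.curryLeft (x 0)) (f.curryLeft (b 0)) (Fin.tail x) (Fin.tail b)).trans ?_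
    simp [MultilinearMap.curryLeft_apply]

variable (g) in
/-- The map `Ψ` in degree `n + 1`; its values on pure tensors are given by `psi_tmul`. -/
noncomputable def psi (n : ℕ) : MultilinearMap k (fun _ : Fin (n + 1) => B) M →ₗ[k]
    (g ⊗[k] B) [⋀^Fin (n + 1)]→ₗ[k] (g ⊗[k] M) where
  toFun f := MultilinearMap.alternatization (tensorMultilinear (n + 1) (leftNormed k g n) f)
  map_add' f f' := by simp
  map_smul' t f := by
    ext v
    simp [MultilinearMap.alternatization_apply, Finset.smul_sum, smul_comm t]

theorem psi_tmul (n : ℕ) (f : MultilinearMap k (fun _ : Fin (n + 1) => B) M)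
    (x : Fin (n + 1) → g) (b : Fin (n + 1) → B) :
    psi g n f (fun i => x i ⊗ₜ[k] b i) = ∑ σ : Equiv.Perm (Fin (n + 1)), Equiv.Perm.sign σ •
      (leftNormed k g n (fun i => x (σ i)) ⊗ₜ[k] f (fun i => b (σ i))) := by
  simp only [psi, LinearMap.coe_mk, AddHom.coe_mk, MultilinearMap.alternatization_apply,
    MultilinearMap.domDomCongr_apply]
  exact Finset.sum_congr rfl fun σ _ => congrArg _
    (tensorMultilinear_tmul (n + 1) (leftNormed k g n) f (fun i => x (σ i)) fun i => b (σ i))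

end Psi

/-! ### The cochain complexes -/

section Quotient

variable {k : Type*} [Field k] {K L : CochainComplex (ModuleCat.{u} k) ℕ}

/-- The quotient complex `L / φ(K)` of a morphism of cochain complexes `φ : K ⟶ L`. -/
noncomputable def quotientComplex (φ : K ⟶ L) : CochainComplex (ModuleCat.{u} k) ℕ where
  X n := ModuleCat.of k (L.X n ⧸ LinearMap.range (φ.f n).hom)
  d i j := ModuleCat.ofHom (Submodule.mapQ _ _ (L.d i j).hom (by
    rintro _ ⟨x, rfl⟩
    exact ⟨(K.d i j).hom x,
      (LinearMap.congr_fun (congrArg ModuleCat.Hom.hom (φ.comm i j)) x).symm⟩))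
  shape i j h := by
    ext x
    simp [L.shape i j h]
  d_comp_d' i j l _ _ := by
    ext x
    have h : (L.d j l).hom ((L.d i j).hom x) = 0 :=
      LinearMap.congr_fun (congrArg ModuleCat.Hom.hom (L.d_comp_d i j l)) x
    exact congrArg (Submodule.mkQ (LinearMap.range (φ.f l).hom)) h

/-- The projection `L ⟶ L / φ(K)`. -/
noncomputable def quotientProj (φ : K ⟶ L) : L ⟶ quotientComplex φ where
  f n := ModuleCat.ofHom (Submodule.mkQ (LinearMap.range (φ.f n).hom))
  comm' i j _ := by
    ext x
    rfl

/-- The sequence of complexes `K ⟶ L ⟶ L / φ(K)`. -/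
noncomputable def quotientSequence (φ : K ⟶ L) :
    ShortComplex (CochainComplex (ModuleCat.{u} k) ℕ) where
  f := φ
  g := quotientProj φ
  zero := by
    ext n x
    exact (Submodule.Quotient.mk_eq_zero _).2 ⟨x, rfl⟩

end Quotient

section Complexes

variable (k : Type*) [Field k]

section DL

variable (B M : Type u) [NonUnitalNonAssocRing B] [Module k B] [IsScalarTower k B B]
  [SMulCommClass k B B] [AddCommGroup M] [Module k M]

/-- The module `C^n_DL(B, M)` of `n`-linear maps `B^n → M` for `n ≥ 1`, and `0` for `n = 0`. -/
def dualLeibnizCochain : ℕ → ModuleCat.{u} k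
  | 0 => ModuleCat.of k PUnit
  | n + 1 => ModuleCat.of k (MultilinearMap k (fun _ : Fin (n + 1) => B) M)

variable [DualLeibnizBimodule k B M]

/-- The differential of `C^*_DL(B, M)`. -/
noncomputable def dualLeibnizD : ∀ n : ℕ, dualLeibnizCochain k B M n ⟶ dualLeibnizCochain k B M (n + 1)
  | 0 => 0
  | n + 1 => ModuleCat.ofHom (dualLeibnizCoboundary (k := k) (B := B) (M := M) (n + 1))

variable {k B M} in
/-- The cochain complex `C^*_DL(B, M)`. -/
noncomputable def dualLeibnizComplex
    (h : ∀ n, dualLeibnizD k B M n ≫ dualLeibnizD k B M (n + 1) = 0) :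
    CochainComplex (ModuleCat.{u} k) ℕ :=
  CochainComplex.of (dualLeibnizCochain k B M) (dualLeibnizD k B M) h

end DL

section Lie

variable [CharZero k] (L N : Type u) [LieRing L] [LieAlgebra k L] [AddCommGroup N] [Module k N]
  [LieRingModule L N] [LieModule k L N]

/-- The module `C^n_Lie(L, N)` of alternating `n`-linear maps `L^n → N`. -/
def lieCochain (n : ℕ) : ModuleCat.{u} k := ModuleCat.of k (L [⋀^Fin n]→ₗ[k] N)

/-- The differential of `C^*_Lie(L, N)`. -/
noncomputable def lieD (n : ℕ) : lieCochain k L N n ⟶ lieCochain k L N (n + 1) :=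
  ModuleCat.ofHom (lieCoboundary n)

variable {k L N} in
/-- The Chevalley-Eilenberg cochain complex `C^*_Lie(L, N)`. -/
noncomputable def lieComplex (h : ∀ n, lieD k L N n ≫ lieD k L N (n + 1) = 0) :
    CochainComplex (ModuleCat.{u} k) ℕ :=
  CochainComplex.of (lieCochain k L N) (lieD k L N) h

end Lie

variable [CharZero k] (g B M : Type u)
  [NonUnitalNonAssocRing g] [Module k g] [IsScalarTower k g g] [SMulCommClass k g g] [IsLeibniz g]
  [NonUnitalNonAssocRing B] [Module k B] [IsScalarTower k B B] [SMulCommClass k B B]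
  [IsDualLeibniz B] [AddCommGroup M] [Module k M] [DualLeibnizBimodule k B M]

/-- The map `Ψ : C^n_DL(B, M) → C^n_Lie(g ⊗ B, g ⊗ M)`. -/
noncomputable def psiHom : ∀ n : ℕ,
    dualLeibnizCochain k B M n ⟶ lieCochain k (g ⊗[k] B) (g ⊗[k] M) n
  | 0 => 0
  | n + 1 => ModuleCat.ofHom (psi g n)

variable {k g B M} in
/-- The morphism of cochain complexes `Ψ : C^*_DL(B, M) ⟶ C^*_Lie(g ⊗ B, g ⊗ M)`. -/
noncomputable def psiMap
    (hDL : ∀ n, dualLeibnizD k B M n ≫ dualLeibnizD k B M (n + 1) = 0)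
    (hLie : ∀ n, lieD k (g ⊗[k] B) (g ⊗[k] M) n ≫ lieD k (g ⊗[k] B) (g ⊗[k] M) (n + 1) = 0)
    (hΨ : ∀ n, psiHom k g B M n ≫ lieD k (g ⊗[k] B) (g ⊗[k] M) n =
      dualLeibnizD k B M n ≫ psiHom k g B M (n + 1)) :
    dualLeibnizComplex hDL ⟶ lieComplex hLie :=
  CochainComplex.ofHom (psiHom k g B M) (fun n => by
    simpa [dualLeibnizComplex, lieComplex] using hΨ n)

end Complexes

end DualLeibniz

open DualLeibniz

/-!
The long exact sequence comes from a short exact sequence of complexes, so the content is that both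
sequences of spaces are complexes and that `Ψ` is an injective cochain map.

* The Lie coboundary squares to zero by Cartan's calculus. Contractions `i_x`, Lie derivatives `θ_x`
  and the coboundary `δ` satisfy `i_x δ + δ i_x = θ_x` (`contraction_lieCoboundary`),
  `i_z θ_x = θ_x i_z - i_[x,z]` (`contraction_lieDerivative`) and
  `θ_[x,y] = θ_x θ_y - θ_y θ_x` (`lieDerivative_lie`). A cochain of positive degree vanishes as soon
  as all its contractions do, so `δ θ_x = θ_x δ` and `δ δ = 0` follow by induction on the degree.

* `Ψ f` is the alternatization of `F(y_1, …, y_n) = [x_1, …, x_n] ⊗ f(b_1, …, b_n)`, where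
  `y_i = x_i ⊗ b_i` and `[x_1, …, x_n]` is the left-normed bracket. For an alternatization, the
  bracket part of `δ` is the alternating sum of the contractions `F(…, y_p y_(p+1), …)`
  (`lieBracketPart_alternatization`), and the action part is the alternating sum of
  `y_1 * F(y_2, …)` (`lieActionPart_alternatization`). The Leibniz identity rewrites the brackets
  `[…, [x_p, x_(p+1)], …]` (`leftNormed_contractNth`) and `[x_1, [x_2, …, x_n]]`
  (`mul_leftNormed`, where the shuffles come from) as combinations of left-normed ones; moving the
  permutations to the other tensor factor gives the dual Leibniz coboundary
  (`psi_dualLeibnizCoboundary_tmul`).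

* `Ψ` is injective because a free Leibniz algebra on two generators has elements `a_0, …, a_n` and a
  linear form that is `1` on `[a_0, …, a_n]` and `0` on the left-normed brackets of all the other
  sequences of terms of `a` (`IsFreeLeibnizOn.exists_dual_leftNormed`). They are found by mapping to
  the Leibniz algebra `W ⊕ End(W)`, where `W` has a basis `e_0, e_1, …`: one generator goes to a
  diagonal operator with distinct eigenvalues of its `ad` on the elementary operators
  `e_m ↦ e_(m+1)`, the other one to the shift together with `e_0`, and `a_i` is cut out by Lagrange
  interpolation.

* Hence the dual Leibniz coboundary squares to zero as well: `Ψ δ δ = δ δ Ψ = 0`.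
-/

namespace DualLeibniz

/-! ### The Chevalley-Eilenberg coboundary squares to zero -/

section AlternatingCurry

variable {k V N : Type*} [Field k] [AddCommGroup V] [Module k V] [AddCommGroup N] [Module k N]

/-- A cochain of positive degree is determined by its contractions. -/
theorem ext_curryLeft {n : ℕ} {f f' : V [⋀^Fin (n + 1)]→ₗ[k] N}
    (h : ∀ x, f.curryLeft x = f'.curryLeft x) : f = f' := by
  ext v
  have := congrArg (fun φ => φ (Fin.tail v)) (h (v 0))
  simpa [AlternatingMap.curryLeft_apply_apply, Matrix.vecCons] using this

theorem curryLeft_curryLeft_swap {n : ℕ} (f : V [⋀^Fin (n + 2)]→ₗ[k] N) (x y : V) :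
    (f.curryLeft x).curryLeft y = -(f.curryLeft y).curryLeft x := by
  have h := AlternatingMap.curryLeft_same f (x + y)
  simp only [map_add, AlternatingMap.curryLeft_add, LinearMap.add_apply,
    AlternatingMap.curryLeft_same, zero_add, add_zero] at h
  exact eq_neg_of_add_eq_zero_right h

/-- Contraction of the first argument, as a linear map. -/
noncomputable def contraction {n : ℕ} (x : V) :
    (V [⋀^Fin (n + 1)]→ₗ[k] N) →ₗ[k] V [⋀^Fin n]→ₗ[k] N where
  toFun f := f.curryLeft x
  map_add' _ _ := rfl
  map_smul' _ _ := rfl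

theorem contraction_apply {n : ℕ} (x : V) (f : V [⋀^Fin (n + 1)]→ₗ[k] N) (v : Fin n → V) :
    contraction x f v = f (Fin.cons x v) := rfl

theorem contraction_alternatizeUncurryFin {n : ℕ} (G : V →ₗ[k] V [⋀^Fin (n + 1)]→ₗ[k] N) (x : V) :
    contraction x (AlternatingMap.alternatizeUncurryFin G) =
      G x - AlternatingMap.alternatizeUncurryFin (contraction x ∘ₗ G) := by
  ext v
  simp only [contraction_apply, AlternatingMap.alternatizeUncurryFin_apply,
    AlternatingMap.sub_apply, LinearMap.comp_apply]
  rw [Fin.sum_univ_succ, sub_eq_add_neg, ← Finset.sum_neg_distrib]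
  congr 1
  · simp
  · refine Finset.sum_congr rfl fun i _ => ?_
    have : i.succ.removeNth (Fin.cons x v : Fin (n + 2) → V) = Fin.cons x (i.removeNth v) := by
      funext j
      refine Fin.cases ?_ (fun j => ?_) j <;> simp [Fin.removeNth]
    rw [this]
    simp [pow_succ]

theorem contraction_alternatizeUncurryFin_zero (G : V →ₗ[k] V [⋀^Fin 0]→ₗ[k] N) (x : V) :
    contraction x (AlternatingMap.alternatizeUncurryFin G) = G x := by
  ext v
  simp only [contraction_apply, AlternatingMap.alternatizeUncurryFin_apply]
  simp [Subsingleton.elim _ v]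

end AlternatingCurry

section Cartan

variable {k L N : Type*} [Field k] [CharZero k] [LieRing L] [LieAlgebra k L]
  [AddCommGroup N] [Module k N] [LieRingModule L N] [LieModule k L N]

/-- The cochain `(x_1, …, x_n) ↦ x * f(x_1, …, x_n)`. -/
noncomputable def actOnValues {n : ℕ} (x : L) :
    (L [⋀^Fin n]→ₗ[k] N) →ₗ[k] L [⋀^Fin n]→ₗ[k] N where
  toFun f := (LieModule.toEnd k L N x).compAlternatingMap f
  map_add' f f' := by ext; simp
  map_smul' t f := by ext; simp

/-- The cochain `(x_1, …, x_n) ↦ ∑_i f(x_1, …, x * x_i, …, x_n)`, in degree `n = m + 1`. It is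
written as the alternating sum of the cochains `f(x * x_i, -)`. -/
noncomputable def actOnArgs {m : ℕ} (x : L) :
    (L [⋀^Fin (m + 1)]→ₗ[k] N) →ₗ[k] L [⋀^Fin (m + 1)]→ₗ[k] N where
  toFun f := AlternatingMap.alternatizeUncurryFin (bracketCurry m f x)
  map_add' f f' := by simp
  map_smul' t f := by simp

/-- The Lie derivative `θ_x` of cochains,
`(θ_x f)(x_1, …, x_n) = x * f(x_1, …, x_n) - ∑_i f(x_1, …, x * x_i, …, x_n)`. -/
noncomputable def lieDerivative : ∀ {n : ℕ} (_ : L),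
    (L [⋀^Fin n]→ₗ[k] N) →ₗ[k] L [⋀^Fin n]→ₗ[k] N
  | 0, x => actOnValues x
  | _ + 1, x => actOnValues x - actOnArgs x

theorem bracketCurry_apply {m : ℕ} (f : L [⋀^Fin (m + 1)]→ₗ[k] N) (x y : L) :
    bracketCurry m f x y = contraction ⁅x, y⁆ f := rfl

theorem contraction_add {n : ℕ} (x y : L) (f : L [⋀^Fin (n + 1)]→ₗ[k] N) :
    contraction (x + y) f = contraction x f + contraction y f :=
  map_add f.curryLeft x y

theorem contraction_neg {n : ℕ} (x : L) (f : L [⋀^Fin (n + 1)]→ₗ[k] N) :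
    contraction (-x) f = -contraction x f :=
  map_neg f.curryLeft x

theorem contraction_swap {n : ℕ} (x y : L) (f : L [⋀^Fin (n + 2)]→ₗ[k] N) :
    contraction x (contraction y f) = -contraction y (contraction x f) :=
  curryLeft_curryLeft_swap f y x

theorem ext_contraction {n : ℕ} {f f' : L [⋀^Fin (n + 1)]→ₗ[k] N}
    (h : ∀ x, contraction x f = contraction x f') : f = f' :=
  ext_curryLeft h

theorem contraction_actOnValues {n : ℕ} (z x : L) (f : L [⋀^Fin (n + 1)]→ₗ[k] N) :
    contraction z (actOnValues x f) = actOnValues x (contraction z f) := rfl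

theorem contraction_comp_bracketCurry {n : ℕ} (z x : L) (f : L [⋀^Fin (n + 2)]→ₗ[k] N) :
    contraction z ∘ₗ bracketCurry (n + 1) f x =
      (-1 : k) • bracketCurry n (contraction z f) x := by
  refine LinearMap.ext fun y => ?_
  rw [LinearMap.smul_apply, neg_one_smul]
  exact contraction_swap z ⁅x, y⁆ f

/-- The commutation rule of contractions and Lie derivatives. -/
theorem contraction_lieDerivative {n : ℕ} (z x : L) (f : L [⋀^Fin (n + 1)]→ₗ[k] N) :
    contraction z (lieDerivative x f) =
      lieDerivative x (contraction z f) - contraction ⁅x, z⁆ f := by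
  cases n with
  | zero =>
    change contraction z (actOnValues x f - actOnArgs x f) = _
    rw [map_sub, contraction_actOnValues]
    congr 1
    exact contraction_alternatizeUncurryFin_zero _ _
  | succ n =>
    change contraction z (actOnValues x f - actOnArgs x f) =
      actOnValues x (contraction z f) - actOnArgs x (contraction z f) - _
    rw [map_sub, contraction_actOnValues, sub_sub]
    congr 1
    refine (contraction_alternatizeUncurryFin _ _).trans ?_
    rw [bracketCurry_apply, sub_eq_add_neg]
    refine (add_comm _ _).trans (congrArg (· + _) ?_)
    change -_ = AlternatingMap.alternatizeUncurryFin (bracketCurry n (contraction z f) x)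
    rw [contraction_comp_bracketCurry, AlternatingMap.alternatizeUncurryFin_smul,
      neg_one_smul, neg_neg]

theorem lieDerivative_lie {n : ℕ} (x y : L) (f : L [⋀^Fin n]→ₗ[k] N) :
    lieDerivative ⁅x, y⁆ f =
      lieDerivative x (lieDerivative y f) - lieDerivative y (lieDerivative x f) := by
  induction n with
  | zero =>
    ext v
    exact lie_lie x y (f v)
  | succ n ih =>
    refine ext_contraction fun z => ?_
    simp only [map_sub, contraction_lieDerivative, ih]
    rw [show ⁅⁅x, y⁆, z⁆ = ⁅x, ⁅y, z⁆⁆ + -⁅y, ⁅x, z⁆⁆ by rw [lie_lie, sub_eq_add_neg],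
      contraction_add, contraction_neg]
    abel

theorem contraction_lieActionPart {n : ℕ} (x : L) (f : L [⋀^Fin (n + 1)]→ₗ[k] N) :
    contraction x (lieActionPart (n + 1) f) =
      actOnValues x f - lieActionPart n (contraction x f) :=
  contraction_alternatizeUncurryFin _ _

/-- Cartan's formula for the part of the coboundary that involves brackets of arguments. -/
theorem contraction_lieBracketPart {m : ℕ} (x : L) (f : L [⋀^Fin (m + 2)]→ₗ[k] N) :
    contraction x (lieBracketPart (m + 1) f) =
      -actOnArgs x f - lieBracketPart m (contraction x f) := by
  have h : contraction x ∘ₗ AlternatingMap.alternatizeUncurryFinLM ∘ₗ bracketCurry (m + 1) f =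
      (-1 : k) • bracketCurry (m + 1) f x +
        AlternatingMap.alternatizeUncurryFinLM ∘ₗ bracketCurry m (contraction x f) := by
    refine LinearMap.ext fun y => ?_
    change contraction x (AlternatingMap.alternatizeUncurryFin (bracketCurry (m + 1) f y)) =
      (-1 : k) • contraction ⁅x, y⁆ f +
        AlternatingMap.alternatizeUncurryFin (bracketCurry m (contraction x f) y)
    rw [contraction_alternatizeUncurryFin, contraction_comp_bracketCurry,
      AlternatingMap.alternatizeUncurryFin_smul, bracketCurry_apply, ← lie_skew, contraction_neg]
    module
  change contraction x ((-2⁻¹ : k) • AlternatingMap.alternatizeUncurryFin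
      (AlternatingMap.alternatizeUncurryFinLM ∘ₗ bracketCurry (m + 1) f)) =
    -AlternatingMap.alternatizeUncurryFin (bracketCurry (m + 1) f x) -
      (-2⁻¹ : k) • AlternatingMap.alternatizeUncurryFin
        (AlternatingMap.alternatizeUncurryFinLM ∘ₗ bracketCurry m (contraction x f))
  rw [map_smul, contraction_alternatizeUncurryFin, h, AlternatingMap.alternatizeUncurryFin_add,
    AlternatingMap.alternatizeUncurryFin_smul]
  change (-2⁻¹ : k) • (AlternatingMap.alternatizeUncurryFin (bracketCurry (m + 1) f x) - _) = _
  module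

theorem contraction_lieBracketPart_zero (x : L) (f : L [⋀^Fin 1]→ₗ[k] N) :
    contraction x (lieBracketPart 0 f) = -actOnArgs x f := by
  have h : contraction x ∘ₗ AlternatingMap.alternatizeUncurryFinLM ∘ₗ bracketCurry 0 f =
      (-1 : k) • bracketCurry 0 f x := by
    refine LinearMap.ext fun y => ?_
    change contraction x (AlternatingMap.alternatizeUncurryFin (bracketCurry 0 f y)) =
      (-1 : k) • contraction ⁅x, y⁆ f
    rw [contraction_alternatizeUncurryFin_zero, bracketCurry_apply, ← lie_skew, contraction_neg]
    module
  change contraction x ((-2⁻¹ : k) • AlternatingMap.alternatizeUncurryFin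
      (AlternatingMap.alternatizeUncurryFinLM ∘ₗ bracketCurry 0 f)) =
    -AlternatingMap.alternatizeUncurryFin (bracketCurry 0 f x)
  rw [map_smul, contraction_alternatizeUncurryFin, h, AlternatingMap.alternatizeUncurryFin_smul]
  change (-2⁻¹ : k) • (AlternatingMap.alternatizeUncurryFin (bracketCurry 0 f x) - _) = _
  module

/-- Cartan's magic formula. -/
theorem contraction_lieCoboundary {n : ℕ} (x : L) (f : L [⋀^Fin (n + 1)]→ₗ[k] N) :
    contraction x (lieCoboundary (n + 1) f) =
      lieDerivative x f - lieCoboundary n (contraction x f) := by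
  cases n with
  | zero =>
    change contraction x (lieBracketPart 0 f + lieActionPart 1 f) =
      actOnValues x f - actOnArgs x f - lieActionPart 0 (contraction x f)
    rw [map_add, contraction_lieBracketPart_zero, contraction_lieActionPart]
    abel
  | succ n =>
    change contraction x (lieBracketPart (n + 1) f + lieActionPart (n + 2) f) =
      actOnValues x f - actOnArgs x f -
        (lieBracketPart n (contraction x f) + lieActionPart (n + 1) (contraction x f))
    rw [map_add, contraction_lieBracketPart, contraction_lieActionPart]
    abel

theorem contraction_lieCoboundary_zero (x : L) (f : L [⋀^Fin 0]→ₗ[k] N) :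
    contraction x (lieCoboundary 0 f) = lieDerivative x f :=
  contraction_alternatizeUncurryFin_zero _ _

theorem lieCoboundary_lieDerivative {n : ℕ} (x : L) (f : L [⋀^Fin n]→ₗ[k] N) :
    lieCoboundary n (lieDerivative x f) = lieDerivative x (lieCoboundary n f) := by
  induction n with
  | zero =>
    refine ext_contraction fun z => ?_
    rw [contraction_lieDerivative, contraction_lieCoboundary_zero, contraction_lieCoboundary_zero,
      contraction_lieCoboundary_zero, lieDerivative_lie]
    abel
  | succ n ih =>
    refine ext_contraction fun z => ?_
    simp only [contraction_lieDerivative, contraction_lieCoboundary, map_sub, ih, lieDerivative_lie]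
    abel

theorem lieCoboundary_lieCoboundary (n : ℕ) (f : L [⋀^Fin n]→ₗ[k] N) :
    lieCoboundary (n + 1) (lieCoboundary n f) = 0 := by
  induction n with
  | zero =>
    refine ext_contraction fun z => ?_
    rw [contraction_lieCoboundary, contraction_lieCoboundary_zero, lieCoboundary_lieDerivative,
      sub_self, map_zero]
  | succ n ih =>
    refine ext_contraction fun z => ?_
    rw [contraction_lieCoboundary, contraction_lieCoboundary, map_sub, ih,
      lieCoboundary_lieDerivative, sub_zero, sub_self, map_zero]

end Cartan

/-! ### Sums over permutations -/

section PermSums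

open Equiv

/-- The permutation of `n + 1` letters with word `i, τ(0)', …, τ(n - 1)'`, where `'` is the order
embedding of `{0, …, n - 1}` that misses `i`. -/
def consPerm {n : ℕ} (i : Fin (n + 1)) (τ : Perm (Fin n)) : Perm (Fin (n + 1)) :=
  i.cycleRange.symm * Perm.decomposeFin.symm (0, τ)

@[simp]
theorem consPerm_zero {n : ℕ} (i : Fin (n + 1)) (τ : Perm (Fin n)) : consPerm i τ 0 = i := by
  simp [consPerm]

@[simp]
theorem consPerm_succ {n : ℕ} (i : Fin (n + 1)) (τ : Perm (Fin n)) (j : Fin n) :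
    consPerm i τ j.succ = i.succAbove (τ j) := by
  simp [consPerm]

theorem sign_consPerm {n : ℕ} (i : Fin (n + 1)) (τ : Perm (Fin n)) :
    Perm.sign (consPerm i τ) = (-1) ^ (i : ℕ) * Perm.sign τ := by
  simp [consPerm, Perm.sign_symm]

/-- Every permutation of `n + 1` letters is `consPerm i τ` for exactly one pair `(i, τ)`. -/
theorem sum_perm_fin_succ {A : Type*} [AddCommMonoid A] {n : ℕ} (H : Perm (Fin (n + 1)) → A) :
    ∑ σ, H σ = ∑ i, ∑ τ, H (consPerm i τ) := by
  rw [← Fintype.sum_prod_type']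
  refine (Fintype.sum_bijective (fun q : Fin (n + 1) × Perm (Fin n) => consPerm q.1 q.2)
    ?_ _ _ fun _ => rfl).symm
  refine (Fintype.bijective_iff_injective_and_card _).2 ⟨?_, ?_⟩
  · rintro ⟨i, τ⟩ ⟨i', τ'⟩ h
    have h0 := congrArg (fun σ : Perm (Fin (n + 1)) => σ 0) h
    simp only [consPerm_zero] at h0
    subst h0
    refine congrArg _ (Equiv.ext fun j => ?_)
    have hj := congrArg (fun σ : Perm (Fin (n + 1)) => σ j.succ) h
    simpa using hj
  · simp [Fintype.card_perm, Nat.factorial_succ]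

end PermSums

section Alternatization

variable {k V N : Type*} [Field k] [AddCommGroup V] [Module k V] [AddCommGroup N] [Module k N]

/-- Expansion of an alternatization according to the position of the first argument. -/
theorem alternatization_cons {m : ℕ} (F : MultilinearMap k (fun _ : Fin (m + 1) => V) N) (x : V)
    (w : Fin m → V) :
    MultilinearMap.alternatization F (Fin.cons x w) = ∑ p : Fin (m + 1), ∑ τ : Equiv.Perm (Fin m),
      ((-1) ^ (p : ℕ) * Equiv.Perm.sign τ) • F (p.insertNth x fun j => w (τ j)) := by
  rw [MultilinearMap.alternatization_apply,
    ← Equiv.sum_comp (Equiv.inv (Equiv.Perm (Fin (m + 1)))), sum_perm_fin_succ]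
  refine Finset.sum_congr rfl fun p _ => ?_
  rw [← Equiv.sum_comp (Equiv.inv (Equiv.Perm (Fin m)))]
  refine Finset.sum_congr rfl fun τ _ => ?_
  simp only [Equiv.inv_apply, Equiv.Perm.sign_inv, sign_consPerm, MultilinearMap.domDomCongr_apply]
  congr 2
  funext q
  obtain ⟨r, rfl⟩ := (consPerm p τ⁻¹).surjective q
  rw [Equiv.Perm.inv_def, Equiv.symm_apply_apply]
  refine Fin.cases ?_ (fun j => ?_) r <;> simp

theorem contractNth_castSucc_eq_insertNth {m : ℕ} (μ : V → V → V) (p : Fin (m + 1))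
    (w : Fin (m + 2) → V) :
    p.castSucc.contractNth μ w = p.insertNth (μ (w p.castSucc) (w p.succ))
      fun j => w (p.castSucc.succAbove (p.succAbove j)) := by
  funext q
  refine Fin.succAboveCases p ?_ (fun j => ?_) q
  · rw [Fin.insertNth_apply_same]
    simp [Fin.contractNth]
  · rw [Fin.insertNth_apply_succAbove]
    rcases lt_or_ge j.castSucc p with h | h
    · have h' : (j : ℕ) < p := h
      simp only [Fin.contractNth, Fin.succAbove, h, if_true, Fin.val_castSucc, h']
      congr 1
      simp [h]
    · have h' : (p : ℕ) ≤ j := h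
      have h1 : ¬ (j.castSucc < p) := not_lt.2 h
      have h2 : ¬ (j : ℕ) + 1 < p := by omega
      have h3 : ¬ (j : ℕ) + 1 = p := by omega
      simp only [Fin.contractNth, Fin.succAbove, h1, if_false, Fin.val_castSucc, Fin.val_succ, h2,
        h3]
      congr 1
      have h4 : ¬ (j.succ.castSucc < p.castSucc) := by
        rw [Fin.lt_def]; simpa using by omega
      simp only [h4, if_false]

/-- Contracting in position `p` or in position `0` gives the same alternating sum up to the sign of
an even permutation and the position of the contracted argument. -/
theorem sum_sign_contractNth {m : ℕ} (F : MultilinearMap k (fun _ : Fin (m + 1) => V) N)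
    (μ : V → V → V) (p : Fin (m + 1)) (v : Fin (m + 2) → V) :
    ∑ σ : Equiv.Perm (Fin (m + 2)), Equiv.Perm.sign σ •
        F (p.castSucc.contractNth μ fun i => v (σ i)) =
      ∑ i : Fin (m + 2), ∑ j : Fin (m + 1), ∑ τ : Equiv.Perm (Fin m),
        ((-1) ^ (i : ℕ) * ((-1) ^ (j : ℕ) * Equiv.Perm.sign τ)) •
          F (p.insertNth (μ (v i) (v (i.succAbove j)))
            fun q => v (i.succAbove (j.succAbove (τ q)))) := by
  -- `ρ` has the word `p, p + 1, 0, 1, …`, so it moves the two contracted arguments to the front.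
  let ρ : Equiv.Perm (Fin (m + 2)) := consPerm p.castSucc (consPerm p 1)
  have hρ : Equiv.Perm.sign ρ = 1 := by
    simp only [ρ, sign_consPerm, Equiv.Perm.sign_one, mul_one, Fin.val_castSucc]
    rw [← pow_add, Even.neg_one_pow ⟨_, rfl⟩]
  have h1 : ρ 0 = p.castSucc := consPerm_zero _ _
  have h2 : ρ (Fin.succ 0) = p.succ := by
    simp only [ρ, consPerm_succ, consPerm_zero]
    simp
  have h3 : ∀ j : Fin m, ρ j.succ.succ = p.castSucc.succAbove (p.succAbove j) := fun j => by
    simp only [ρ, consPerm_succ, Equiv.Perm.one_apply]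
  have h : ∀ σ : Equiv.Perm (Fin (m + 2)), Equiv.Perm.sign σ •
        F (p.castSucc.contractNth μ fun i => v (σ i)) =
      Equiv.Perm.sign (σ * ρ) • F (p.insertNth (μ (v ((σ * ρ) 0)) (v ((σ * ρ) (Fin.succ 0))))
        fun q => v ((σ * ρ) q.succ.succ)) := fun σ => by
    simp only [contractNth_castSucc_eq_insertNth, Equiv.Perm.mul_apply, h1, h2, h3, map_mul, hρ,
      mul_one]
  refine (Finset.sum_congr rfl fun σ _ => h σ).trans ?_
  refine (Equiv.sum_comp (Equiv.mulRight ρ)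
    (fun σ => Equiv.Perm.sign σ • F (p.insertNth (μ (v (σ 0)) (v (σ (Fin.succ 0))))
        fun q => v (σ q.succ.succ)))).trans ?_
  rw [sum_perm_fin_succ]
  refine Finset.sum_congr rfl fun i _ => ?_
  rw [sum_perm_fin_succ]
  refine Finset.sum_congr rfl fun j _ => Finset.sum_congr rfl fun τ _ => ?_
  simp only [sign_consPerm, consPerm_zero, consPerm_succ]

end Alternatization

section LieParts

variable {k L N : Type*} [Field k] [CharZero k] [LieRing L] [LieAlgebra k L]
  [AddCommGroup N] [Module k N] [LieRingModule L N] [LieModule k L N]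

/-- If the Lie bracket is the commutator of a product `μ`, then the bracket part of the coboundary
of an alternatization is the alternating sum of contractions of adjacent arguments. -/
theorem lieBracketPart_alternatization {m : ℕ} (μ : L →ₗ[k] L →ₗ[k] L)
    (hμ : ∀ x y : L, ⁅x, y⁆ = μ x y - μ y x)
    (F : MultilinearMap k (fun _ : Fin (m + 1) => L) N) (v : Fin (m + 2) → L) :
    lieBracketPart m (MultilinearMap.alternatization F) v =
      ∑ p : Fin (m + 1), (-1 : ℤˣ) ^ ((p : ℕ) + 1) • ∑ σ : Equiv.Perm (Fin (m + 2)),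
        Equiv.Perm.sign σ • F (p.castSucc.contractNth (fun x y => μ x y) fun i => v (σ i)) := by
  -- The definition of `lieBracketPart` antisymmetrizes `f(⁅x, y⁆, -)` over all the ordered pairs
  -- and halves; antisymmetrizing `f(μ x y, -)` instead gives the bracket without the factor `2`.
  let G : L →ₗ[k] L →ₗ[k] L [⋀^Fin m]→ₗ[k] N :=
    μ.compr₂ (MultilinearMap.alternatization F).curryLeft
  have hG : ∀ x y w, G x y w = MultilinearMap.alternatization F (Fin.cons (μ x y) w) :=
    fun _ _ _ => rfl
  have h1 : lieBracketPart m (MultilinearMap.alternatization F) v =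
      -AlternatingMap.alternatizeUncurryFin (AlternatingMap.alternatizeUncurryFinLM ∘ₗ G) v := by
    rw [lieBracketPart_apply,
      AlternatingMap.alternatizeUncurryFin_alternatizeUncurryFinLM_comp_apply,
      ← Finset.sum_neg_distrib]
    refine Finset.sum_congr rfl fun i _ => ?_
    rw [← Finset.sum_neg_distrib]
    refine Finset.sum_congr rfl fun j _ => ?_
    have hs : MultilinearMap.alternatization F
          (Fin.cons ⁅v i.castSucc, v j.succ⁆ (j.removeNth (i.castSucc.removeNth v))) =
        G (v i.castSucc) (v j.succ) (j.removeNth (i.castSucc.removeNth v)) -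
          G (v j.succ) (v i.castSucc) (j.removeNth (i.castSucc.removeNth v)) := by
      rw [hμ]
      exact congrArg (fun φ : L [⋀^Fin m]→ₗ[k] N => φ (j.removeNth (i.castSucc.removeNth v)))
        (map_sub (MultilinearMap.alternatization F).curryLeft _ _)
    rw [hs, ← neg_smul]
    congr 1
    ring
  rw [h1]
  simp only [sum_sign_contractNth]
  simp only [AlternatingMap.alternatizeUncurryFin_apply, LinearMap.comp_apply,
    AlternatingMap.alternatizeUncurryFinLM_apply, hG, alternatization_cons]
  simp only [Finset.smul_sum, ← Finset.sum_neg_distrib]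
  symm
  rw [Finset.sum_comm]
  refine Finset.sum_congr rfl fun i _ => ?_
  rw [Finset.sum_comm]
  refine Finset.sum_congr rfl fun j _ => Finset.sum_congr rfl fun p _ =>
    Finset.sum_congr rfl fun τ _ => ?_
  simp only [Units.smul_def, smul_smul, ← neg_smul]
  congr 1
  push_cast
  ring

theorem lieActionPart_alternatization {n : ℕ} (F : MultilinearMap k (fun _ : Fin n => L) N)
    (v : Fin (n + 1) → L) :
    lieActionPart n (MultilinearMap.alternatization F) v =
      ∑ σ : Equiv.Perm (Fin (n + 1)), Equiv.Perm.sign σ • ⁅v (σ 0), F fun j => v (σ j.succ)⁆ := by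
  rw [lieActionPart_apply, sum_perm_fin_succ]
  refine Finset.sum_congr rfl fun i _ => ?_
  rw [MultilinearMap.alternatization_apply, ← LieModule.toEnd_apply_apply k, map_sum,
    Finset.smul_sum]
  refine Finset.sum_congr rfl fun τ _ => ?_
  rw [sign_consPerm]
  simp only [consPerm_zero, consPerm_succ, Units.smul_def, map_zsmul, smul_smul]
  congr 1

end LieParts

/-! ### Shuffle words -/

section ShuffleWords

open Equiv

/-- A word in `n` letters that decreases up to position `i`, excluded, increases from position `i`
on, and has its smallest letter in position `i`: the inverse of an `IsInverseShuffle`. -/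
def IsShuffleWord {n : ℕ} (i : Fin n) (w : Perm (Fin n)) : Prop :=
  StrictAntiOn w {p | p < i} ∧ StrictMonoOn w {p | i ≤ p} ∧ ((w i : Fin n) : ℕ) = 0

theorem isInverseShuffle_inv {n : ℕ} (i : Fin n) (π : Perm (Fin n)) :
    IsInverseShuffle i π⁻¹ ↔ IsShuffleWord i π := by
  rw [IsInverseShuffle, inv_inv, IsShuffleWord]

theorem injective_snoc_last {n : ℕ} (π : Perm (Fin n)) :
    Function.Injective (Fin.snoc (α := fun _ => Fin (n + 1)) (fun p => (π p).castSucc)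
      (Fin.last n)) := by
  rw [Fin.snoc_injective_iff]
  refine ⟨(Fin.castSucc_injective n).comp π.injective, ?_⟩
  rintro ⟨p, hp⟩
  exact (Fin.castSucc_lt_last (π p)).ne hp

theorem injective_cons_last {n : ℕ} (π : Perm (Fin n)) :
    Function.Injective (Fin.cons (α := fun _ => Fin (n + 1)) (Fin.last n)
      fun p => (π p).castSucc) := by
  rw [Fin.cons_injective_iff]
  refine ⟨?_, (Fin.castSucc_injective n).comp π.injective⟩
  rintro ⟨p, hp⟩
  exact (Fin.castSucc_lt_last (π p)).ne hp

/-- The word `π` with a new largest letter at the end. -/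
noncomputable def snocLast {n : ℕ} (π : Perm (Fin n)) : Perm (Fin (n + 1)) :=
  Equiv.ofBijective _ (Finite.injective_iff_bijective.1 (injective_snoc_last π))

/-- The word `π` with a new largest letter at the beginning. -/
noncomputable def consLast {n : ℕ} (π : Perm (Fin n)) : Perm (Fin (n + 1)) :=
  Equiv.ofBijective _ (Finite.injective_iff_bijective.1 (injective_cons_last π))

@[simp] theorem snocLast_castSucc {n : ℕ} (π : Perm (Fin n)) (p : Fin n) :
    snocLast π p.castSucc = (π p).castSucc :=
  Fin.snoc_castSucc (α := fun _ => Fin (n + 1)) (Fin.last n) (fun p => (π p).castSucc) p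

@[simp] theorem snocLast_last {n : ℕ} (π : Perm (Fin n)) : snocLast π (Fin.last n) = Fin.last n :=
  Fin.snoc_last (α := fun _ => Fin (n + 1)) (Fin.last n) (fun p => (π p).castSucc)

@[simp] theorem consLast_zero {n : ℕ} (π : Perm (Fin n)) : consLast π 0 = Fin.last n := rfl

@[simp] theorem consLast_succ {n : ℕ} (π : Perm (Fin n)) (p : Fin n) :
    consLast π p.succ = (π p).castSucc := rfl

theorem isShuffleWord_snocLast {n : ℕ} (i : Fin n) (π : Perm (Fin n)) :
    IsShuffleWord i.castSucc (snocLast π) ↔ IsShuffleWord i π := by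
  simp only [IsShuffleWord, StrictAntiOn, StrictMonoOn, Set.mem_ofPred_eq]
  refine and_congr ?_ (and_congr ?_ ?_)
  · constructor
    · intro h p hp q hq hpq
      simpa using @h p.castSucc (by simpa) q.castSucc (by simpa) (by simpa)
    · intro h p hp q hq hpq
      induction p using Fin.lastCases with
      | last => exact absurd hp (not_lt.2 (Fin.le_last _))
      | cast p =>
      induction q using Fin.lastCases with
      | last => exact absurd hq (not_lt.2 (Fin.le_last _))
      | cast q => simpa using @h p (by simpa using hp) q (by simpa using hq) (by simpa using hpq)
  · constructor
    · intro h p hp q hq hpq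
      simpa using @h p.castSucc (by simpa) q.castSucc (by simpa) (by simpa)
    · intro h p hp q hq hpq
      induction p using Fin.lastCases with
      | last => exact absurd hpq (not_lt.2 (Fin.le_last _))
      | cast p =>
      induction q using Fin.lastCases with
      | last => simp
      | cast q => simpa using @h p (by simpa using hp) q (by simpa using hq) (by simpa using hpq)
  · simp

theorem isShuffleWord_consLast {n : ℕ} (i : Fin n) (π : Perm (Fin n)) :
    IsShuffleWord i.succ (consLast π) ↔ IsShuffleWord i π := by
  simp only [IsShuffleWord, StrictAntiOn, StrictMonoOn, Set.mem_ofPred_eq]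
  refine and_congr ?_ (and_congr ?_ ?_)
  · constructor
    · intro h p hp q hq hpq
      simpa using @h p.succ (by simpa) q.succ (by simpa) (by simpa)
    · intro h p hp q hq hpq
      induction q using Fin.cases with
      | zero => exact absurd hpq (not_lt.2 (Fin.zero_le _))
      | succ q =>
      induction p using Fin.cases with
      | zero => simp
      | succ p => simpa using @h p (by simpa using hp) q (by simpa using hq) (by simpa using hpq)
  · constructor
    · intro h p hp q hq hpq
      simpa using @h p.succ (by simpa) q.succ (by simpa) (by simpa)
    · intro h p hp q hq hpq
      induction p using Fin.cases with
      | zero => exact absurd hp (not_le.2 (Fin.succ_pos _))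
      | succ p =>
      induction q using Fin.cases with
      | zero => exact absurd hq (not_le.2 (Fin.succ_pos _))
      | succ q => simpa using @h p (by simpa using hp) q (by simpa using hq) (by simpa using hpq)
  · simp

theorem exists_eq_snocLast {n : ℕ} (π : Perm (Fin (n + 1))) (h : π (Fin.last n) = Fin.last n) :
    ∃ π', π = snocLast π' := by
  have hne : ∀ p : Fin n, ∃ q : Fin n, q.castSucc = π p.castSucc := fun p =>
    Fin.exists_castSucc_eq.2 fun hp =>
      (Fin.castSucc_lt_last p).ne (π.injective (hp.trans h.symm))
  choose w hw using hne
  have hinj : Function.Injective w := fun p q hpq =>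
    Fin.castSucc_injective n (π.injective (by rw [← hw, ← hw, hpq]))
  refine ⟨Equiv.ofBijective w (Finite.injective_iff_bijective.1 hinj), Equiv.ext fun p => ?_⟩
  induction p using Fin.lastCases with
  | last => simpa using h
  | cast p => simp [hw]

theorem exists_eq_consLast {n : ℕ} (π : Perm (Fin (n + 1))) (h : π 0 = Fin.last n) :
    ∃ π', π = consLast π' := by
  have hne : ∀ p : Fin n, ∃ q : Fin n, q.castSucc = π p.succ := fun p =>
    Fin.exists_castSucc_eq.2 fun hp =>
      (Fin.succ_pos p).ne' (π.injective (hp.trans h.symm))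
  choose w hw using hne
  have hinj : Function.Injective w := fun p q hpq =>
    Fin.succ_injective n (π.injective (by rw [← hw, ← hw, hpq]))
  refine ⟨Equiv.ofBijective w (Finite.injective_iff_bijective.1 hinj), Equiv.ext fun p => ?_⟩
  induction p using Fin.cases with
  | zero => simpa using h
  | succ p => simp [hw]

/-- The largest letter of a shuffle word is its last or its first one. -/
theorem IsShuffleWord.last_or_zero {n : ℕ} {i : Fin (n + 1)} {π : Perm (Fin (n + 1))}
    (h : IsShuffleWord i π) : π (Fin.last n) = Fin.last n ∨ π 0 = Fin.last n ∧ i ≠ 0 := by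
  obtain ⟨q, hq⟩ := π.surjective (Fin.last n)
  rcases le_or_gt i q with hiq | hiq
  · rcases (Fin.le_last q).eq_or_lt with rfl | hlt
    · exact Or.inl hq
    · have := h.2.1 hiq (Fin.le_last i) hlt
      exact absurd (hq ▸ this) (not_lt.2 (Fin.le_last _))
  · have hi : i ≠ 0 := (lt_of_le_of_lt (Fin.zero_le q) hiq).ne'
    rcases (Fin.zero_le q).eq_or_lt with rfl | hlt
    · exact Or.inr ⟨hq, hi⟩
    · have := h.1 (lt_trans hlt hiq) hiq hlt
      exact absurd (hq ▸ this) (not_lt.2 (Fin.le_last _))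

open Classical in
/-- The shuffle words in `n + 2` letters arise from those in `n + 1` letters by adding the largest
letter at the end or at the beginning. -/
theorem sum_isShuffleWord_succ {A : Type*} [AddCommMonoid A] {n : ℕ}
    (H : Fin (n + 2) → Perm (Fin (n + 2)) → A) :
    ∑ i, ∑ π : Perm (Fin (n + 2)) with IsShuffleWord i π, H i π =
      ∑ i : Fin (n + 1), ∑ π : Perm (Fin (n + 1)) with IsShuffleWord i π,
        (H i.castSucc (snocLast π) + H i.succ (consLast π)) := by
  simp only [Finset.sum_filter, ← Fintype.sum_prod_type']
  simp only [← Finset.sum_filter]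
  rw [← Finset.sum_filter_add_sum_filter_not _
    (fun q : Fin (n + 2) × Perm (Fin (n + 2)) => q.2 (Fin.last (n + 1)) = Fin.last (n + 1)),
    Finset.sum_add_distrib]
  congr 1
  · symm
    refine Finset.sum_nbij (fun q => (q.1.castSucc, snocLast q.2)) ?_ ?_ ?_ fun _ _ => rfl
    · rintro ⟨i, π⟩ h
      simp only [Finset.mem_filter, Finset.mem_univ, true_and] at h ⊢
      exact ⟨(isShuffleWord_snocLast i π).2 h, snocLast_last π⟩
    · rintro ⟨i, π⟩ _ ⟨i', π'⟩ _ h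
      obtain ⟨h1, h2⟩ := Prod.mk.inj h
      refine Prod.ext (Fin.castSucc_injective _ h1) (Equiv.ext fun p => ?_)
      have := congrArg (fun σ : Perm (Fin (n + 2)) => σ p.castSucc) h2
      simpa using this
    · rintro ⟨i, π⟩ h
      simp only [Finset.coe_filter, Finset.mem_filter, Finset.mem_univ, true_and,
        Set.mem_ofPred_eq] at h
      obtain ⟨π', rfl⟩ := exists_eq_snocLast π h.2
      obtain ⟨i', rfl⟩ : ∃ i' : Fin (n + 1), i'.castSucc = i := Fin.exists_castSucc_eq.2 (by
        rintro rfl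
        have := h.1.2.2
        rw [snocLast_last] at this
        simp at this)
      exact ⟨(i', π'), by simpa using (isShuffleWord_snocLast i' π').1 h.1, rfl⟩
  · symm
    refine Finset.sum_nbij (fun q => (q.1.succ, consLast q.2)) ?_ ?_ ?_ fun _ _ => rfl
    · rintro ⟨i, π⟩ h
      simp only [Finset.mem_filter, Finset.mem_univ, true_and] at h ⊢
      refine ⟨(isShuffleWord_consLast i π).2 h, ?_⟩
      rw [← Fin.succ_last, consLast_succ]
      exact (Fin.castSucc_lt_last _).ne
    · rintro ⟨i, π⟩ _ ⟨i', π'⟩ _ h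
      obtain ⟨h1, h2⟩ := Prod.mk.inj h
      refine Prod.ext (Fin.succ_injective _ h1) (Equiv.ext fun p => ?_)
      have := congrArg (fun σ : Perm (Fin (n + 2)) => σ p.succ) h2
      simpa using this
    · rintro ⟨i, π⟩ h
      simp only [Finset.coe_filter, Finset.mem_filter, Finset.mem_univ, true_and,
        Set.mem_ofPred_eq] at h
      obtain ⟨h0, hi⟩ := h.1.last_or_zero.resolve_left h.2
      obtain ⟨π', rfl⟩ := exists_eq_consLast π h0
      obtain ⟨i', rfl⟩ := Fin.exists_succ_eq.2 hi
      exact ⟨(i', π'), by simpa using (isShuffleWord_consLast i' π').1 h.1, rfl⟩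

end ShuffleWords

/-! ### Left-normed brackets in a Leibniz algebra -/

section LeftNormed

variable {k g : Type*} [Field k]
  [NonUnitalNonAssocRing g] [Module k g] [IsScalarTower k g g] [SMulCommClass k g g]

theorem leftNormed_snoc (n : ℕ) (x : Fin (n + 1) → g) (a : g) :
    leftNormed k g (n + 1) (Fin.snoc (α := fun _ => g) x a) = leftNormed k g n x * a := by
  rw [leftNormed_succ, Fin.init_snoc, Fin.snoc_last]

theorem leftNormed_cons_cons (n : ℕ) (a b : g) (x : Fin n → g) :
    leftNormed k g (n + 1) (Fin.cons a (Fin.cons b x : Fin (n + 1) → g)) =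
      leftNormed k g n (Fin.cons (a * b) x) := by
  induction n with
  | zero => rfl
  | succ n ih =>
    rw [← Fin.snoc_init_self x]
    simp only [Fin.cons_snoc_eq_snoc_cons]
    rw [leftNormed_snoc, leftNormed_snoc, ih]

theorem leftNormed_contractNth_zero (n : ℕ) (x : Fin (n + 2) → g) :
    leftNormed k g n ((0 : Fin (n + 2)).contractNth (fun a b => a * b) x) =
      leftNormed k g (n + 1) x := by
  have h1 : x = Fin.cons (x 0) (Fin.cons (x 1) (Fin.tail (Fin.tail x)) : Fin (n + 1) → g) := by
    funext i
    refine Fin.cases rfl (fun i => ?_) i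
    refine Fin.cases rfl (fun i => rfl) i
  have h2 : (0 : Fin (n + 2)).contractNth (fun a b => a * b) x =
      Fin.cons (x 0 * x 1) (Fin.tail (Fin.tail x)) := by
    funext i
    refine Fin.cases ?_ (fun i => ?_) i
    · simp [Fin.contractNth]
    · simp [Fin.contractNth, Fin.tail]
  rw [h2, h1, leftNormed_cons_cons]
  rfl

variable [IsLeibniz g]

/-- The Leibniz identity in the form `[u, [x, y], …] = [u, x, y, …] - [u, y, x, …]`. The hypothesis
`0 < p` says that the contracted pair is preceded by some `u`. -/
theorem leftNormed_contractNth (n : ℕ) (p : Fin (n + 1)) (hp : 0 < (p : ℕ)) (x : Fin (n + 2) → g) :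
    leftNormed k g n (p.castSucc.contractNth (fun a b => a * b) x) =
      leftNormed k g (n + 1) x -
        leftNormed k g (n + 1) (fun i => x (Equiv.swap p.castSucc p.succ i)) := by
  induction n with
  | zero => omega
  | succ n ih =>
    induction p using Fin.lastCases with
    | last =>
      have h1 : Fin.init ((Fin.last (n + 1)).castSucc.contractNth (fun a b => a * b) x) =
          Fin.init (Fin.init x) := by
        funext i
        simp only [Fin.init, Fin.contractNth, Fin.val_castSucc, Fin.val_last]
        rw [if_pos i.2]
      have h2 : (Fin.last (n + 1)).castSucc.contractNth (fun a b => a * b) x (Fin.last (n + 1)) =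
          x (Fin.last (n + 1)).castSucc * x (Fin.last (n + 2)) := by
        simp [Fin.contractNth]
      have h3 : Fin.init (Fin.init fun i =>
          x (Equiv.swap (Fin.last (n + 1)).castSucc (Fin.last (n + 1)).succ i)) =
          Fin.init (Fin.init x) := by
        funext i
        simp only [Fin.init]
        rw [Equiv.swap_apply_of_ne_of_ne] <;> simp [Fin.ext_iff] <;> omega
      rw [leftNormed_succ, h1, h2, leftNormed_succ, leftNormed_succ, leftNormed_succ,
        leftNormed_succ, h3, IsLeibniz.leibniz]
      simp [Fin.init, ← Fin.succ_last]
    | cast p =>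
      have h1 : Fin.init (p.castSucc.castSucc.contractNth (fun a b => a * b) x) =
          p.castSucc.contractNth (fun a b => a * b) (Fin.init x) := by
        funext i
        simp [Fin.init, Fin.contractNth]
      have h2 : p.castSucc.castSucc.contractNth (fun a b => a * b) x (Fin.last (n + 1)) =
          x (Fin.last (n + 2)) := by
        have hp := p.2
        simp only [Fin.contractNth, Fin.val_castSucc, Fin.val_last]
        rw [if_neg (by omega), if_neg (by omega)]
        simp
      have h3 : (Fin.init fun i => x (Equiv.swap p.castSucc.castSucc p.castSucc.succ i)) =
          fun i => Fin.init x (Equiv.swap p.castSucc p.succ i) := by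
        funext i
        simp only [Fin.init, Equiv.swap_apply_def, Fin.ext_iff, Fin.val_castSucc, Fin.val_succ]
        congr 1
        split_ifs <;> rfl
      have h4 : Equiv.swap p.castSucc.castSucc p.castSucc.succ (Fin.last (n + 2)) =
          Fin.last (n + 2) := by
        have hp := p.2
        rw [Equiv.swap_apply_of_ne_of_ne] <;> simp [Fin.ext_iff] <;> omega
      rw [leftNormed_succ, h1, h2, ih p (by simpa using hp), leftNormed_succ (n + 1),
        leftNormed_succ (n + 1), h3,
        h4, sub_mul]

open Classical in
/-- Right multiplication by a left-normed bracket, as a signed sum of iterated right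
multiplications: since right multiplication by `[w, v]` is the commutator of those by `w` and by
`v`, every letter after the first one is put either at the end or, with a sign, at the beginning of
the word, which yields the shuffle words. -/
theorem mul_leftNormed (n : ℕ) (u : g) (v : Fin (n + 1) → g) :
    u * leftNormed k g n v = ∑ i : Fin (n + 1), ∑ π : Equiv.Perm (Fin (n + 1)) with
      IsShuffleWord i π, (-1 : ℤ) ^ (i : ℕ) •
        leftNormed k g (n + 1) (Fin.cons u fun p => v (π p)) := by
  induction n generalizing u with
  | zero =>
    have h : ∀ π : Equiv.Perm (Fin 1), IsShuffleWord 0 π := fun π =>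
      ⟨fun p hp => absurd hp (Fin.not_lt_zero p), fun p _ q _ hpq => by omega, by omega⟩
    simp [h, leftNormed_succ, Fin.init]
  | succ n ih =>
    rw [sum_isShuffleWord_succ (fun i π => (-1 : ℤ) ^ (i : ℕ) •
        leftNormed k g (n + 2) (Fin.cons u fun p => v (π p))), leftNormed_succ,
      IsLeibniz.leibniz, ih, ih (u * v (Fin.last (n + 1)))]
    simp only [Finset.sum_mul, Finset.sum_add_distrib, sub_eq_add_neg, ← Finset.sum_neg_distrib]
    congr 1
    · refine Finset.sum_congr rfl fun i _ => Finset.sum_congr rfl fun π _ => ?_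
      rw [smul_mul_assoc, ← leftNormed_snoc, ← Fin.cons_snoc_eq_snoc_cons, Fin.val_castSucc]
      congr 3
      funext p
      induction p using Fin.lastCases <;> simp [Fin.init]
    · refine Finset.sum_congr rfl fun i _ => Finset.sum_congr rfl fun π _ => ?_
      rw [← leftNormed_cons_cons, Fin.val_succ, pow_succ, mul_neg_one, neg_smul]
      congr 4
      funext p
      induction p using Fin.cases <;> simp [Fin.init]

end LeftNormed

/-! ### The map `Ψ` commutes with the coboundaries -/

section ChainMap

variable {k g B M : Type*} [Field k]
  [NonUnitalNonAssocRing g] [Module k g] [IsScalarTower k g g] [SMulCommClass k g g] [IsLeibniz g]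
  [NonUnitalNonAssocRing B] [Module k B] [IsScalarTower k B B] [SMulCommClass k B B]
  [AddCommGroup M] [Module k M]

theorem neg_one_pow_units_smul (n : ℕ) (m : M) : (-1 : ℤˣ) ^ n • m = (-1 : k) ^ n • m := by
  rcases n.even_or_odd with h | h
  · rw [h.neg_one_pow, h.neg_one_pow, one_smul, one_smul]
  · rw [h.neg_one_pow, h.neg_one_pow, Units.neg_smul, neg_smul, one_smul, one_smul]

theorem contractNth_tmul {n : ℕ} (p : Fin (n + 1)) (x : Fin (n + 1) → g) (b : Fin (n + 1) → B) :
    p.contractNth (fun y z => y * z) (fun i => x i ⊗ₜ[k] b i) =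
      fun i => p.contractNth (fun y z => y * z) x i ⊗ₜ[k] p.contractNth (fun y z => y * z) b i := by
  funext i
  simp only [Fin.contractNth]
  split_ifs <;> simp

/-- Exchanging the two contracted arguments amounts to contracting with the opposite product. -/
theorem contractNth_comp_swap {A : Type*} {n : ℕ} (μ : A → A → A) (p : Fin (n + 1))
    (b : Fin (n + 2) → A) :
    (p.castSucc.contractNth μ fun i => b (Equiv.swap p.castSucc p.succ i)) =
      p.castSucc.contractNth (fun y z => μ z y) b := by
  funext i
  simp only [Fin.contractNth, Equiv.swap_apply_def, Fin.ext_iff, Fin.val_castSucc, Fin.val_succ]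
  split_ifs <;> first | rfl | omega | skip
  obtain rfl : i = p := Fin.ext (by omega)
  rfl

/-- The alternating sum of the contractions of `[x_1, …, x_n] ⊗ f(b_1, …, b_n)` at a given position:
by the Leibniz identity, a contraction that is not the first one gives rise to the two products of
neighbouring arguments of `f`. -/
theorem sum_sign_tensorMultilinear_contractNth (n : ℕ)
    (f : MultilinearMap k (fun _ : Fin (n + 1) => B) M) (p : Fin (n + 1)) (x : Fin (n + 2) → g)
    (b : Fin (n + 2) → B) :
    ∑ σ : Equiv.Perm (Fin (n + 2)), Equiv.Perm.sign σ •
        tensorMultilinear (n + 1) (leftNormed k g n) f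
          (p.castSucc.contractNth (fun y z => y * z) fun i => x (σ i) ⊗ₜ[k] b (σ i)) =
      ∑ σ : Equiv.Perm (Fin (n + 2)), Equiv.Perm.sign σ •
        (leftNormed k g (n + 1) (fun i => x (σ i)) ⊗ₜ[k]
          (f (p.castSucc.contractNth (fun y z => y * z) fun i => b (σ i)) +
            if 0 < (p : ℕ) then f (p.castSucc.contractNth (fun y z => z * y) fun i => b (σ i))
              else 0)) := by
  have h : ∀ σ : Equiv.Perm (Fin (n + 2)), tensorMultilinear (n + 1) (leftNormed k g n) f
      (p.castSucc.contractNth (fun y z => y * z) fun i => x (σ i) ⊗ₜ[k] b (σ i)) =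
      leftNormed k g n (p.castSucc.contractNth (fun y z => y * z) fun i => x (σ i)) ⊗ₜ[k]
        f (p.castSucc.contractNth (fun y z => y * z) fun i => b (σ i)) := fun σ => by
    rw [contractNth_tmul, tensorMultilinear_tmul]
  simp only [h]
  split_ifs with hp
  · simp only [leftNormed_contractNth n p hp, TensorProduct.sub_tmul, TensorProduct.tmul_add,
      smul_sub, smul_add, Finset.sum_sub_distrib, Finset.sum_add_distrib]
    rw [sub_eq_add_neg, ← Finset.sum_neg_distrib]
    congr 1
    rw [← Equiv.sum_comp (Equiv.mulRight (Equiv.swap p.castSucc p.succ))]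
    refine Finset.sum_congr rfl fun σ _ => ?_
    have hs : Equiv.Perm.sign (Equiv.swap p.castSucc p.succ) = -1 :=
      Equiv.Perm.sign_swap (Fin.castSucc_lt_succ).ne
    simp only [Equiv.coe_mulRight, Equiv.Perm.sign_mul, hs, Equiv.Perm.mul_apply,
      Equiv.swap_apply_self, mul_neg_one,
      contractNth_comp_swap (fun y z : B => y * z) p fun i => b (σ i)]
    simp only [Units.smul_def, Units.val_neg, neg_smul, neg_neg]
  · obtain rfl : p = 0 := Fin.ext (by simpa using hp)
    simp only [Fin.castSucc_zero, leftNormed_contractNth_zero, add_zero]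

variable [IsDualLeibniz B] [DualLeibnizBimodule k B M]

open DualLeibnizBimodule

/-- The part `[a', a] ⊗ (m · b)` of the action, brought to left-normed form by a cyclic rotation of
the arguments. -/
theorem sum_sign_leftNormed_mul (n : ℕ)
    (f : MultilinearMap k (fun _ : Fin (n + 1) => B) M) (x : Fin (n + 2) → g)
    (b : Fin (n + 2) → B) :
    ∑ σ : Equiv.Perm (Fin (n + 2)), Equiv.Perm.sign σ •
        ((leftNormed k g n (fun j => x (σ j.succ)) * x (σ 0)) ⊗ₜ[k]
          ract (k := k) (f fun j => b (σ j.succ)) (b (σ 0))) =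
      (-1 : ℤˣ) ^ (n + 1) • ∑ σ : Equiv.Perm (Fin (n + 2)), Equiv.Perm.sign σ •
        (leftNormed k g (n + 1) (fun i => x (σ i)) ⊗ₜ[k]
          ract (k := k) (f (Fin.init fun i => b (σ i))) (b (σ (Fin.last (n + 1))))) := by
  rw [← Equiv.sum_comp (Equiv.mulRight (finRotate (n + 2))) (fun σ => Equiv.Perm.sign σ •
        (leftNormed k g (n + 1) (fun i => x (σ i)) ⊗ₜ[k]
          ract (k := k) (f (Fin.init fun i => b (σ i))) (b (σ (Fin.last (n + 1)))))),
    Finset.smul_sum]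
  refine Finset.sum_congr rfl fun σ _ => ?_
  have h0 : finRotate (n + 2) (Fin.last (n + 1)) = 0 := finRotate_last
  have h1 : ∀ i : Fin (n + 1), finRotate (n + 2) i.castSucc = i.succ := fun i => by
    rw [finRotate_apply]; simp
  simp only [Equiv.coe_mulRight, Equiv.Perm.sign_mul, sign_finRotate, Equiv.Perm.mul_apply,
    leftNormed_succ, Fin.init_def, h0, h1, smul_smul]
  congr 1
  rw [mul_left_comm, show n + 2 - 1 = n + 1 from rfl, ← mul_pow]
  simp

open Classical in
/-- The part `[a, a'] ⊗ (b · m)` of the action, brought to left-normed form by `mul_leftNormed`: the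
shuffle words move from the brackets to the arguments of `f`, where they become inverse. -/
theorem sum_sign_mul_leftNormed (n : ℕ)
    (f : MultilinearMap k (fun _ : Fin (n + 1) => B) M) (x : Fin (n + 2) → g)
    (b : Fin (n + 2) → B) :
    ∑ σ : Equiv.Perm (Fin (n + 2)), Equiv.Perm.sign σ •
        ((x (σ 0) * leftNormed k g n (fun j => x (σ j.succ))) ⊗ₜ[k]
          lact (k := k) (b (σ 0)) (f fun j => b (σ j.succ))) =
      ∑ σ : Equiv.Perm (Fin (n + 2)), Equiv.Perm.sign σ •
        (leftNormed k g (n + 1) (fun i => x (σ i)) ⊗ₜ[k]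
          lact (k := k) (b (σ 0)) (∑ i : Fin (n + 1),
            ∑ ρ : Equiv.Perm (Fin (n + 1)) with IsInverseShuffle i ρ,
            ((-1) ^ (i : ℕ) * ((Equiv.Perm.sign ρ : ℤ) : k)) • f (fun p => b (σ (ρ p).succ)))) := by
  simp only [mul_leftNormed, TensorProduct.sum_tmul, map_sum, TensorProduct.tmul_sum,
    Finset.smul_sum]
  rw [Finset.sum_comm]
  conv_rhs => rw [Finset.sum_comm]
  refine Finset.sum_congr rfl fun i _ => ?_
  simp only [Finset.sum_filter]
  rw [Finset.sum_comm]
  conv_rhs => rw [Finset.sum_comm]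
  rw [← Equiv.sum_comp (Equiv.inv (Equiv.Perm (Fin (n + 1))))]
  refine Finset.sum_congr rfl fun ρ _ => ?_
  simp only [Equiv.inv_apply, ← isInverseShuffle_inv, inv_inv]
  by_cases h : IsInverseShuffle i ρ
  · simp only [h, if_true]
    -- `consPerm 0 ρ` fixes the first argument and permutes the other ones by `ρ`.
    rw [← Equiv.sum_comp (Equiv.mulRight (consPerm 0 ρ))]
    refine Finset.sum_congr rfl fun σ _ => ?_
    have hx : (Fin.cons (x (σ 0)) fun p => x (σ (ρ (ρ⁻¹ p)).succ) : Fin (n + 2) → g) =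
        fun i => x (σ i) := by
      funext p
      refine Fin.cases rfl (fun p => ?_) p
      simp [Equiv.Perm.inv_def]
    simp only [Equiv.coe_mulRight, Equiv.Perm.mul_apply, consPerm_zero, consPerm_succ,
      Fin.zero_succAbove, Equiv.Perm.sign_mul, sign_consPerm, hx, map_smul,
      TensorProduct.tmul_smul, ← TensorProduct.smul_tmul', Fin.val_zero, pow_zero, one_mul,
      Units.smul_def, smul_smul, Units.val_mul]
    rw [show ((-1) ^ (i : ℕ) * ((Equiv.Perm.sign ρ : ℤ) : k)) =
      (((-1) ^ (i : ℕ) * (Equiv.Perm.sign ρ : ℤ) : ℤ) : k) by push_cast; rfl,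
      Int.cast_smul_eq_zsmul, smul_smul]
    congr 1
    ring
  · simp only [h, if_false]

theorem psi_dualLeibnizCoboundary_tmul [CharZero k] (n : ℕ)
    (f : MultilinearMap k (fun _ : Fin (n + 1) => B) M) (x : Fin (n + 2) → g)
    (b : Fin (n + 2) → B) :
    psi g (n + 1) (dualLeibnizCoboundary (n + 1) f) (fun i => x i ⊗ₜ[k] b i) =
      lieCoboundary (n + 1) (psi g n f) (fun i => x i ⊗ₜ[k] b i) := by
  have hμ : ∀ y z : g ⊗[k] B, ⁅y, z⁆ = LinearMap.mul k (g ⊗[k] B) y z -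
    LinearMap.mul k (g ⊗[k] B) z y := fun y z => rfl
  change _ = lieBracketPart n (MultilinearMap.alternatization
      (tensorMultilinear (n + 1) (leftNormed k g n) f)) (fun i => x i ⊗ₜ[k] b i) +
    lieActionPart (n + 1) (MultilinearMap.alternatization
      (tensorMultilinear (n + 1) (leftNormed k g n) f)) (fun i => x i ⊗ₜ[k] b i)
  rw [lieBracketPart_alternatization _ hμ, lieActionPart_alternatization, psi_tmul]
  simp only [LinearMap.mul_apply', sum_sign_tensorMultilinear_contractNth, tensorMultilinear_tmul,
    lie_tmul_tmul_module, smul_sub, Finset.sum_sub_distrib, sum_sign_leftNormed_mul,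
    sum_sign_mul_leftNormed, dualLeibnizCoboundary_apply, TensorProduct.tmul_add, smul_add,
    Finset.sum_add_distrib]
  -- A signed sum over the contracted position passes through the alternating sum.
  have key : ∀ h : Fin (n + 1) → Equiv.Perm (Fin (n + 2)) → M,
      ∑ σ : Equiv.Perm (Fin (n + 2)), Equiv.Perm.sign σ •
          (leftNormed k g (n + 1) (fun i => x (σ i)) ⊗ₜ[k]
            ∑ p : Fin (n + 1), (-1 : k) ^ ((p : ℕ) + 1) • h p σ) =
        ∑ p : Fin (n + 1), (-1 : ℤˣ) ^ ((p : ℕ) + 1) • ∑ σ : Equiv.Perm (Fin (n + 2)),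
          Equiv.Perm.sign σ • (leftNormed k g (n + 1) (fun i => x (σ i)) ⊗ₜ[k] h p σ) := by
    intro h
    simp only [TensorProduct.tmul_sum, Finset.smul_sum]
    rw [Finset.sum_comm]
    refine Finset.sum_congr rfl fun p _ => Finset.sum_congr rfl fun σ _ => ?_
    rw [TensorProduct.tmul_smul, ← neg_one_pow_units_smul (k := k), smul_comm]
  have h3 : ∑ σ : Equiv.Perm (Fin (n + 2)), Equiv.Perm.sign σ •
        (leftNormed k g (n + 1) (fun i => x (σ i)) ⊗ₜ[k]
          ∑ p ∈ Finset.univ.filter (fun p : Fin (n + 1) => 0 < (p : ℕ)), (-1 : k) ^ ((p : ℕ) + 1) •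
            f (p.castSucc.contractNth (fun y z => z * y) fun i => b (σ i))) =
      ∑ p : Fin (n + 1), (-1 : ℤˣ) ^ ((p : ℕ) + 1) • ∑ σ : Equiv.Perm (Fin (n + 2)),
        Equiv.Perm.sign σ • (leftNormed k g (n + 1) (fun i => x (σ i)) ⊗ₜ[k]
          if 0 < (p : ℕ) then f (p.castSucc.contractNth (fun y z => z * y) fun i => b (σ i))
            else 0) := by
    rw [← key fun p σ => if 0 < (p : ℕ) then
      f (p.castSucc.contractNth (fun y z => z * y) fun i => b (σ i)) else 0]
    simp only [Finset.sum_filter, smul_ite, smul_zero]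
  have h4 : ∑ σ : Equiv.Perm (Fin (n + 2)), Equiv.Perm.sign σ •
        (leftNormed k g (n + 1) (fun i => x (σ i)) ⊗ₜ[k] ((-1 : k) ^ (n + 1 + 1) •
          ract (k := k) (f (Fin.init fun i => b (σ i))) (b (σ (Fin.last (n + 1)))))) =
      -((-1 : ℤˣ) ^ (n + 1) • ∑ σ : Equiv.Perm (Fin (n + 2)), Equiv.Perm.sign σ •
        (leftNormed k g (n + 1) (fun i => x (σ i)) ⊗ₜ[k]
          ract (k := k) (f (Fin.init fun i => b (σ i))) (b (σ (Fin.last (n + 1)))))) := by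
    rw [neg_one_pow_units_smul (k := k), ← neg_smul, Finset.smul_sum]
    refine Finset.sum_congr rfl fun σ _ => ?_
    rw [TensorProduct.tmul_smul, smul_comm, pow_succ _ (n + 1), mul_neg_one]
  rw [key fun p σ => f (p.castSucc.contractNth (fun y z => y * z) fun i => b (σ i)), h3, h4]
  have rearrange : ∀ P Q R S : g ⊗[k] M, P + Q + R + -S = Q + R + (P - S) := by
    intros
    abel
  exact rearrange _ _ _ _

end ChainMap

theorem alternatingMap_ext_tmul {k g B N : Type*} [Field k] [AddCommGroup g] [Module k g]
    [AddCommGroup B] [Module k B] [AddCommGroup N] [Module k N] {n : ℕ}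
    {F F' : (g ⊗[k] B) [⋀^Fin n]→ₗ[k] N}
    (h : ∀ (x : Fin n → g) (b : Fin n → B),
      F (fun i => x i ⊗ₜ[k] b i) = F' fun i => x i ⊗ₜ[k] b i) : F = F' := by
  let e := (Module.Basis.ofVectorSpace k g).tensorProduct (Module.Basis.ofVectorSpace k B)
  refine AlternatingMap.coe_multilinearMap_injective
    (Module.Basis.ext_multilinear (fun _ => e) fun v => ?_)
  simp only [e, Module.Basis.tensorProduct_apply']
  exact h _ _

theorem psi_dualLeibnizCoboundary {k g B M : Type*} [Field k] [CharZero k]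
    [NonUnitalNonAssocRing g] [Module k g] [IsScalarTower k g g] [SMulCommClass k g g]
    [IsLeibniz g] [NonUnitalNonAssocRing B] [Module k B] [IsScalarTower k B B]
    [SMulCommClass k B B] [IsDualLeibniz B] [AddCommGroup M] [Module k M]
    [DualLeibnizBimodule k B M] (n : ℕ) (f : MultilinearMap k (fun _ : Fin (n + 1) => B) M) :
    psi g (n + 1) (dualLeibnizCoboundary (n + 1) f) = lieCoboundary (n + 1) (psi g n f) :=
  alternatingMap_ext_tmul (psi_dualLeibnizCoboundary_tmul n f)

/-! ### Injectivity of `Ψ` -/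

section Hemisemidirect

/-- The hemisemidirect product of the Lie algebra `End(W)` and the vector space `W`, on which it
acts from the right: `[(w, l), (w', l')] = (l'(w), l' ∘ l - l ∘ l')`. -/
def Hemisemidirect (k W : Type*) [Field k] [AddCommGroup W] [Module k W] := W × Module.End k W

namespace Hemisemidirect

variable {k W : Type*} [Field k] [AddCommGroup W] [Module k W]

noncomputable instance : AddCommGroup (Hemisemidirect k W) :=
  inferInstanceAs (AddCommGroup (W × Module.End k W))

noncomputable instance : Module k (Hemisemidirect k W) :=
  inferInstanceAs (Module k (W × Module.End k W))

variable (k W) in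
/-- The component in `W`. -/
def vec : Hemisemidirect k W →ₗ[k] W := LinearMap.fst k W (Module.End k W)

variable (k W) in
/-- The component in `End(W)`. -/
def op : Hemisemidirect k W →ₗ[k] Module.End k W := LinearMap.snd k W (Module.End k W)

/-- The element with the given components. -/
def mk (w : W) (l : Module.End k W) : Hemisemidirect k W := (w, l)

@[simp] theorem vec_mk (w : W) (l : Module.End k W) : vec k W (mk w l) = w := rfl

@[simp] theorem op_mk (w : W) (l : Module.End k W) : op k W (mk w l) = l := rfl

theorem ext {a b : Hemisemidirect k W} (h : vec k W a = vec k W b) (h' : op k W a = op k W b) :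
    a = b :=
  Prod.ext h h'

noncomputable instance : Mul (Hemisemidirect k W) where
  mul a b := mk (op k W b (vec k W a)) (op k W b * op k W a - op k W a * op k W b)

@[simp] theorem vec_mul (a b : Hemisemidirect k W) :
    vec k W (a * b) = op k W b (vec k W a) := rfl

@[simp] theorem op_mul (a b : Hemisemidirect k W) :
    op k W (a * b) = op k W b * op k W a - op k W a * op k W b := rfl

noncomputable instance : NonUnitalNonAssocRing (Hemisemidirect k W) where
  left_distrib a b c := ext (by simp) (by simp [add_mul, mul_add]; abel)
  right_distrib a b c := ext (by simp) (by simp [add_mul, mul_add]; abel)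
  zero_mul a := ext (by simp) (by simp)
  mul_zero a := ext (by simp) (by simp)

instance : IsScalarTower k (Hemisemidirect k W) (Hemisemidirect k W) where
  smul_assoc t a b := ext (by simp) (by simp [smul_sub])

instance : SMulCommClass k (Hemisemidirect k W) (Hemisemidirect k W) where
  smul_comm t a b := ext (by simp) (by simp [smul_sub])

instance : IsLeibniz (Hemisemidirect k W) where
  leibniz a b c := ext (by simp) (by simp [mul_sub, sub_mul, mul_assoc]; abel)

end Hemisemidirect

end Hemisemidirect

section Free

variable {k X g : Type*} [Field k] [NonUnitalNonAssocRing g] [Module k g]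
  [IsScalarTower k g g] [SMulCommClass k g g] [IsLeibniz g]

/-- The universal property of a free Leibniz algebra. -/
theorem IsFreeLeibnizOn.exists_hom {ι : X → g} (hι : IsFreeLeibnizOn k ι) {h : Type*}
    [NonUnitalNonAssocRing h] [Module k h] [IsScalarTower k h h] [SMulCommClass k h h]
    [IsLeibniz h] (j : X → h) :
    ∃ φ : g →ₗ[k] h, (∀ a b, φ (a * b) = φ a * φ b) ∧ ∀ x, φ (ι x) = j x := by
  let F := FreeLeibniz.lift k ι
  let G := FreeLeibniz.lift k j
  let e : FreeLeibniz k X ≃ₗ[k] g :=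
    LinearEquiv.ofBijective (F : FreeLeibniz k X →ₗ[k] g) hι
  have he : ∀ a, e a = F a := fun _ => rfl
  refine ⟨(G : FreeLeibniz k X →ₗ[k] h) ∘ₗ e.symm.toLinearMap, fun a b => ?_, fun x => ?_⟩
  · have : e.symm (a * b) = e.symm a * e.symm b := by
      rw [LinearEquiv.symm_apply_eq, he, map_mul, ← he, ← he, LinearEquiv.apply_symm_apply,
        LinearEquiv.apply_symm_apply]
    change G (e.symm (a * b)) = G (e.symm a) * G (e.symm b)
    rw [this, map_mul]
  · have : e.symm (ι x) = FreeLeibniz.of k x := by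
      rw [LinearEquiv.symm_apply_eq, he, FreeLeibniz.lift_of]
    change G (e.symm (ι x)) = j x
    rw [this, FreeLeibniz.lift_of]

open Polynomial Hemisemidirect

theorem map_aeval_mulRight {h : Type*}
    [NonUnitalNonAssocRing h] [Module k h] [IsScalarTower k h h] [SMulCommClass k h h]
    (φ : g →ₗ[k] h) (hφ : ∀ a b, φ (a * b) = φ a * φ b) (x y : g) (p : k[X]) :
    φ (aeval (LinearMap.mulRight k x) p y) = aeval (LinearMap.mulRight k (φ x)) p (φ y) := by
  induction p using Polynomial.induction_on with
  | C a => simp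
  | add p q hp hq => simp [hp, hq]
  | monomial n a ih =>
    rw [pow_succ', mul_left_comm]
    generalize C a * X ^ n = q at ih
    rw [map_mul, map_mul, aeval_X, aeval_X, Module.End.mul_apply, Module.End.mul_apply, ← ih,
      LinearMap.mulRight_apply, LinearMap.mulRight_apply, hφ]

variable (k) in
/-- The diagonal operator `e_m ↦ m (m + 1) e_m` on the space with basis `e_0, e_1, …`. -/
noncomputable def diagOp : Module.End k (ℕ →₀ k) :=
  Finsupp.lsum k fun m => ((m : k) * (m + 1)) • Finsupp.lsingle m

variable (k) in
/-- The shift `e_m ↦ e_(m+1)`. -/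
noncomputable def shiftOp : Module.End k (ℕ →₀ k) :=
  Finsupp.lsum k fun m => Finsupp.lsingle (m + 1)

theorem diagOp_single (m : ℕ) (t : k) :
    diagOp k (Finsupp.single m t) = ((m : k) * (m + 1)) • Finsupp.single m t := by
  simp [diagOp]

theorem shiftOp_single (m : ℕ) (t : k) :
    shiftOp k (Finsupp.single m t) = Finsupp.single (m + 1) t := by
  simp [shiftOp]

/-- The commutator with the diagonal operator multiplies the `m`-th coefficient of a weighted shift
by `(m + 1)(m + 2) - m (m + 1) = 2 (m + 1)`, and the diagonal operator kills `e_0`. Hence a polynomial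
`p` in the right multiplication by the diagonal operator takes the value `p(0)` on `e_0` and the
value `p(2 (m + 1))` on the `m`-th coefficient of the shift. -/
theorem aeval_mulRight_diagOp (p : k[X]) :
    vec k _ (aeval (LinearMap.mulRight k (mk 0 (diagOp k))) p
        (mk (Finsupp.single 0 1) (shiftOp k))) = p.eval 0 • Finsupp.single 0 1 ∧
      ∀ m : ℕ, op k _ (aeval (LinearMap.mulRight k (mk 0 (diagOp k))) p
        (mk (Finsupp.single 0 1) (shiftOp k))) (Finsupp.single m 1) =
          p.eval (2 * ((m : k) + 1)) • Finsupp.single (m + 1) 1 := by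
  induction p using Polynomial.induction_on with
  | C a => simp [shiftOp_single]
  | add p q hp hq => simp [hp.1, hq.1, hp.2, hq.2, add_smul]
  | monomial n a ih =>
    rw [pow_succ', mul_left_comm]
    generalize C a * X ^ n = q at ih
    rw [map_mul, aeval_X, Module.End.mul_apply, LinearMap.mulRight_apply, vec_mul, op_mul, ih.1]
    refine ⟨by simp [diagOp_single], fun m => ?_⟩
    rw [LinearMap.sub_apply, Module.End.mul_apply, Module.End.mul_apply, ih.2, op_mk, map_smul,
      diagOp_single, diagOp_single, map_smul, ih.2, smul_smul, smul_smul, ← sub_smul, eval_mul,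
      eval_X]
    congr 1
    push_cast
    ring

/-- In a free Leibniz algebra on at least two generators there are, for every `n`, elements
`a_0, …, a_n` such that `[a_0, …, a_n]` is not in the span of the left-normed brackets of the other
sequences of `n + 1` terms of `a`. -/
theorem IsFreeLeibnizOn.exists_dual_leftNormed [CharZero k] [Nontrivial X] {ι : X → g}
    (hι : IsFreeLeibnizOn k ι) (n : ℕ) :
    ∃ (a : Fin (n + 1) → g) (φ : g →ₗ[k] k), ∀ s : Fin (n + 1) → Fin (n + 1),
      φ (leftNormed k g n fun i => a (s i)) = if s = id then 1 else 0 := by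
  classical
  obtain ⟨x, y, hxy⟩ := exists_pair_ne X
  obtain ⟨ψ, hψ, hj⟩ := hι.exists_hom (fun z => if z = x then mk 0 (diagOp k) else
    mk (Finsupp.single 0 1) (shiftOp k))
  have hx := hj x
  have hy := hj y
  simp only [if_true, if_neg hxy.symm] at hx hy
  -- The nodes `0, 2, 4, …` are the eigenvalue `0` on `e_0` and those on the coefficients of the
  -- shift, so `a_i` is mapped to `e_0` for `i = 0` and to `e_(i-1) ↦ e_i` for `i > 0`, up to terms that do
  -- not contribute to the coefficient of `e_n`.
  let P : Fin (n + 1) → k[X] := Lagrange.basis Finset.univ fun i : Fin (n + 1) => 2 * (i : k)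
  have hinj : Set.InjOn (fun i : Fin (n + 1) => 2 * ((i : ℕ) : k))
      (Finset.univ : Finset (Fin (n + 1))) := fun i _ j _ hij =>
    Fin.ext (Nat.cast_injective (R := k) (mul_left_cancel₀ two_ne_zero hij))
  have hP : ∀ i j : Fin (n + 1), (P i).eval (2 * ((j : ℕ) : k)) = if i = j then 1 else 0 := by
    intro i j
    split_ifs with h
    · subst h
      exact Lagrange.eval_basis_self hinj (Finset.mem_univ i)
    · exact Lagrange.eval_basis_of_ne (v := fun i : Fin (n + 1) => 2 * ((i : ℕ) : k)) h
        (Finset.mem_univ j)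
  let a : Fin (n + 1) → g := fun i => aeval (LinearMap.mulRight k (ι x)) (P i) (ι y)
  have ha : ∀ i, ψ (a i) = aeval (LinearMap.mulRight k (mk 0 (diagOp k))) (P i)
      (mk (Finsupp.single 0 1) (shiftOp k)) := fun i => by
    rw [map_aeval_mulRight ψ hψ, hx, hy]
  -- Only the component in `W` of the first factor matters: the other factors act on it, and each of
  -- them raises the index of the basis vector by one.
  have key : ∀ (m : ℕ) (s : Fin (m + 1) → Fin (n + 1)),
      vec k _ (ψ (leftNormed k g m fun i => a (s i))) =
        (∏ i, (P (s i)).eval (2 * ((i : ℕ) : k))) • Finsupp.single m 1 := by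
    intro m
    induction m with
    | zero =>
      intro s
      simp [ha, (aeval_mulRight_diagOp _).1]
    | succ m ih =>
      intro s
      rw [leftNormed_succ, hψ, vec_mul, Fin.init_def, ih fun i => s i.castSucc, map_smul, ha,
        (aeval_mulRight_diagOp _).2, smul_smul, Fin.prod_univ_castSucc (n := m + 1)]
      simp only [Fin.val_castSucc, Fin.val_last, Nat.cast_succ]
  refine ⟨a, Finsupp.lapply n ∘ₗ vec k _ ∘ₗ ψ, fun s => ?_⟩
  rw [LinearMap.comp_apply, LinearMap.comp_apply, key]
  simp only [hP, map_smul, Finsupp.lapply_apply, Finsupp.single_eq_same, smul_eq_mul, mul_one]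
  split_ifs with h
  · simp [h]
  · obtain ⟨i, hi⟩ := Function.ne_iff.1 h
    exact Finset.prod_eq_zero (Finset.mem_univ i) (if_neg hi)

theorem psi_injective [CharZero k] [Nontrivial X] {ι : X → g} (hι : IsFreeLeibnizOn k ι)
    {B M : Type*} [AddCommGroup B] [Module k B] [AddCommGroup M] [Module k M] (n : ℕ) :
    Function.Injective (psi (k := k) (B := B) (M := M) g n) := by
  refine (injective_iff_map_eq_zero _).2 fun f hf => ?_
  obtain ⟨a, φ, hφ⟩ := hι.exists_dual_leftNormed n
  ext b
  have h := congrArg (fun F : (g ⊗[k] B) [⋀^Fin (n + 1)]→ₗ[k] (g ⊗[k] M) =>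
    TensorProduct.lift ((LinearMap.lsmul k M).comp φ) (F fun i => a i ⊗ₜ[k] b i)) hf
  simp only [psi_tmul, map_sum, AlternatingMap.zero_apply, map_zero, Units.smul_def, map_zsmul,
    TensorProduct.lift.tmul, LinearMap.comp_apply, LinearMap.lsmul_apply] at h
  rw [Finset.sum_eq_single 1] at h
  · have h1 : φ (leftNormed k g n fun i => a i) = 1 := (hφ id).trans (if_pos rfl)
    simpa [h1] using h
  · intro σ _ hσ
    rw [hφ fun i => σ i, if_neg, zero_smul, smul_zero]
    exact fun h' => hσ (Equiv.ext fun i => congrFun h' i)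
  · simp

end Free

/-! ### The complexes and the long exact sequence -/

section Differentials

variable (k : Type*) [Field k] [CharZero k]

theorem lieD_comp_lieD (L N : Type u) [LieRing L] [LieAlgebra k L] [AddCommGroup N] [Module k N]
    [LieRingModule L N] [LieModule k L N] (n : ℕ) : lieD k L N n ≫ lieD k L N (n + 1) = 0 :=
  ModuleCat.hom_ext (LinearMap.ext fun f => lieCoboundary_lieCoboundary n f)

variable (g B M : Type u)
  [NonUnitalNonAssocRing g] [Module k g] [IsScalarTower k g g] [SMulCommClass k g g] [IsLeibniz g]
  [NonUnitalNonAssocRing B] [Module k B] [IsScalarTower k B B] [SMulCommClass k B B]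
  [IsDualLeibniz B] [AddCommGroup M] [Module k M] [DualLeibnizBimodule k B M]

theorem psiHom_comp_lieD (n : ℕ) : psiHom k g B M n ≫ lieD k (g ⊗[k] B) (g ⊗[k] M) n =
    dualLeibnizD k B M n ≫ psiHom k g B M (n + 1) := by
  cases n with
  | zero => exact Limits.zero_comp.trans Limits.zero_comp.symm
  | succ n =>
    exact ModuleCat.hom_ext (LinearMap.ext fun f => (psi_dualLeibnizCoboundary n f).symm)

variable {k g}

theorem psiHom_injective {X : Type*} [Nontrivial X] {ι : X → g} (hι : IsFreeLeibnizOn k ι) (n : ℕ) :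
    Function.Injective (psiHom k g B M n) := by
  cases n with
  | zero => exact fun (x y : PUnit) _ => Subsingleton.elim x y
  | succ n => exact psi_injective hι n

/-- The map `Ψ` is injective and commutes with the coboundaries, and the Lie coboundary squares to
zero, so the dual Leibniz coboundary squares to zero, too. -/
theorem dualLeibnizD_comp_dualLeibnizD {X : Type*} [Nontrivial X] {ι : X → g}
    (hι : IsFreeLeibnizOn k ι) (n : ℕ) : dualLeibnizD k B M n ≫ dualLeibnizD k B M (n + 1) = 0 := by
  have : Mono (psiHom k g B M (n + 2)) :=
    (ModuleCat.mono_iff_injective _).2 (psiHom_injective B M hι (n + 2))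
  rw [← cancel_mono (psiHom k g B M (n + 2)), Category.assoc, ← psiHom_comp_lieD, ← Category.assoc,
    ← psiHom_comp_lieD, Category.assoc, lieD_comp_lieD, Limits.comp_zero, Limits.zero_comp]

end Differentials

section Quotient

variable {k : Type*} [Field k] {K L : CochainComplex (ModuleCat.{u} k) ℕ}

theorem quotientSequence_shortExact (φ : K ⟶ L) (h : ∀ n, Function.Injective (φ.f n)) :
    (quotientSequence φ).ShortExact := by
  refine HomologicalComplex.shortExact_of_degreewise_shortExact _ fun n => ?_
  refine ModuleCat.shortComplex_shortExact _ (fun x => ?_) (h n)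
    (Submodule.mkQ_surjective (LinearMap.range (φ.f n).hom))
  exact Submodule.Quotient.mk_eq_zero (LinearMap.range (φ.f n).hom)

end Quotient

end DualLeibniz

theorem corollary4p6 {k : Type*} [Field k] [CharZero k]
    -- a Leibniz algebra `g` that is free on a set `X` with at least two elements
    {X : Type*} [Nontrivial X] {g : Type u} [NonUnitalNonAssocRing g] [Module k g]
    [IsScalarTower k g g] [SMulCommClass k g g] [IsLeibniz g]
    (ι : X → g) (hι : IsFreeLeibnizOn k ι)
    -- a dual Leibniz algebra `B` and a `B`-bimodule `M`
    {B : Type u} [NonUnitalNonAssocRing B] [Module k B] [IsScalarTower k B B]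
    [SMulCommClass k B B] [IsDualLeibniz B]
    {M : Type u} [AddCommGroup M] [Module k M] [DualLeibnizBimodule k B M] :
    -- `C^*_DL(B, M)` and `C^*_Lie(g ⊗ B, g ⊗ M)` are complexes and `Ψ` is a cochain map
    ∃ (hDL : ∀ n, dualLeibnizD k B M n ≫ dualLeibnizD k B M (n + 1) = 0)
      (hLie : ∀ n, lieD k (g ⊗[k] B) (g ⊗[k] M) n ≫ lieD k (g ⊗[k] B) (g ⊗[k] M) (n + 1) = 0)
      (hΨ : ∀ n, psiHom k g B M n ≫ lieD k (g ⊗[k] B) (g ⊗[k] M) n =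
        dualLeibnizD k B M n ≫ psiHom k g B M (n + 1)),
      -- the sequence `0 → C^*_DL → C^*_Lie → Q^* → 0` is exact
      ∃ hS : (quotientSequence (psiMap hDL hLie hΨ)).ShortExact,
        -- the long exact sequence in cohomology, with the connecting maps of the snake lemma
        Function.Injective
          (HomologicalComplex.homologyMap (psiMap hDL hLie hΨ) 0) ∧
        ∀ n : ℕ,
          Function.Exact
            (HomologicalComplex.homologyMap (psiMap hDL hLie hΨ) n)
            (HomologicalComplex.homologyMap (quotientProj (psiMap hDL hLie hΨ)) n) ∧
          Function.Exact
            (HomologicalComplex.homologyMap (quotientProj (psiMap hDL hLie hΨ)) n)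
            (hS.δ n (n + 1) rfl) ∧
          Function.Exact
            (hS.δ n (n + 1) rfl)
            (HomologicalComplex.homologyMap (psiMap hDL hLie hΨ) (n + 1)) := by
  have hDL := dualLeibnizD_comp_dualLeibnizD B M hι
  have hLie := lieD_comp_lieD k (g ⊗[k] B) (g ⊗[k] M)
  have hΨ := psiHom_comp_lieD k g B M
  have hS : (quotientSequence (psiMap hDL hLie hΨ)).ShortExact :=
    quotientSequence_shortExact _ (psiHom_injective B M hι)
  refine ⟨hDL, hLie, hΨ, hS, ?_, fun n => ⟨?_, ?_, ?_⟩⟩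
  · have h0 : Limits.IsZero ((dualLeibnizComplex hDL).homology 0) := by
      refine ShortComplex.isZero_homology_of_isZero_X₂ _ ?_
      exact ModuleCat.isZero_of_subsingleton (ModuleCat.of k PUnit.{u + 1})
    have := ModuleCat.subsingleton_of_isZero h0
    exact Function.injective_of_subsingleton _
  · exact (ShortComplex.ShortExact.moduleCat_exact_iff_function_exact _).1 (hS.homology_exact₂ n)
  · exact (ShortComplex.ShortExact.moduleCat_exact_iff_function_exact _).1
      (hS.homology_exact₃ n (n + 1) rfl)
  · exact (ShortComplex.ShortExact.moduleCat_exact_iff_function_exact _).1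
      (hS.homology_exact₁ n (n + 1) rfl)
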